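/- Let $\mathbb H=\{(z_1,z_2)\in\mathbb C^2:|z_1|<|z_2|<1\}$ be the Hartogs triangle, $\mathbb D$ the open unit disc, $\mathbb D^*=\mathbb D\setminus\{0\}$, and let $\phi:\mathbb H\to\mathbb D\times\mathbb D^*$, $\phi(z_1,z_2)=(z_1/z_2,z_2)$, with inverse $\phi^{-1}(w_1,w_2)=(w_1w_2,w_2)$. For $s\in\mathbb R$ let $L^p_s(\mathbb H)$ be the $L^p$ space of the measure $|z_2|^s\,dV$ on $\mathbb H$, i.e. $\|g\|^p_{L^p_s(\mathbb H)}=\int_{\mathbb H}|g|^p|z_2|^s\,dV$. All derivatives below are taken in the weak (distributional) sense. For a $(0,1)$-form $f=f_1\,d\bar w_1+f_2\,d\bar w_2$ on $\mathbb D\times\mathbb D^*$ put $\mathscr D f=\frac12\big(\frac{\partial f_1}{\partial\bar w_2}+\frac{\partial f_2}{\partial\bar w_1}\big)$ and $$T(f)(w)=\frac{-1}{2\pi i}\int_{\mathbb D^*}\frac{f_2(w_1,\zeta_2)}{\zeta_2-w_2}\,d\bar\zeta_2\wedge d\zeta_2+\frac{-1}{2\pi i}\int_{\mathbb D}\frac{f_1(\zeta_1,w_2)}{\zeta_1-w_1}\,d\bar\zeta_1\wedge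 d\zeta_1+\frac{-1}{(2\pi i)^2}\int_{\mathbb D\times\mathbb D^*}\frac{\mathscr D f(\zeta_1,\zeta_2)}{(\zeta_1-w_1)(\zeta_2-w_2)}\,d\bar\zeta_1\wedge d\zeta_1\wedge d\bar\zeta_2\wedge d\zeta_2 ,$$ where $d\bar\zeta\wedge d\zeta=2i\,dA(\zeta)$ in each variable. **Theorem.** Let $1\le p<\infty$. There is a constant $C>0$, depending only on $p$, such that the following holds. Let $\alpha=\alpha_1\,d\bar z_1+\alpha_2\,d\bar z_2$ be a $(0,1)$-form on $\mathbb H$ that is $\bar\partial$-closed in the weak sense, and assume that 1. $\alpha_1,\alpha_2\in L^p_{-2}(\mathbb H)$; 2. $\partial\alpha_2/\partial\bar z_1=\partial\alpha_1/\partial\bar z_2\in L^p_{-1}(\mathbb H)$ and $\partial\alpha_1/\partial\bar z_1\in L^p_{-1}(\mathbb H)$. Let $f=(\phi^{-1})^*\alpha$, that is, $f_1=\bar w_2\cdot(\alpha_1\circ\phi^{-1})$ and $f_2=\bar w_1\cdot(\alpha_1\circ\phi^{-1})+\alpha_2\circ\phi^{-1}$. Then $f_1$, $f_2$ and $\mathscr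 D f$ belong to $L^p(\mathbb D\times\mathbb D^*)$, the integrals defining $T(f)(w)$ converge absolutely for almost every $w\in\mathbb D\times\mathbb D^*$, and $v=T(f)\circ\phi$ is a weak solution of $\bar\partial v=\alpha$ on $\mathbb H$ that satisfies $$\|v\|_{L^p(\mathbb H)}\le C\Big(\sum_{j=1}^2\|\alpha_j\|_{L^p_{-2}(\mathbb H)}+\sum_{j=1}^2\Big\|\frac{\partial\alpha_1}{\partial\bar z_j}\Big\|_{L^p_{-1}(\mathbb H)}\Big).$$ -/

import Mathlib

open MeasureTheory Complex
open scoped ENNReal NNReal ContDiff ComplexConjugate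

noncomputable section

namespace HartogsDbar

/-- The Hartogs triangle `{(z₁, z₂) : |z₁| < |z₂| < 1}`. -/
def hartogs : Set (ℂ × ℂ) := {z | ‖z.1‖ < ‖z.2‖ ∧ ‖z.2‖ < 1}

/-- The open unit disc. -/
def disc : Set ℂ := {z | ‖z‖ < 1}

/-- The punctured unit disc. -/
def puncDisc : Set ℂ := {z | 0 < ‖z‖ ∧ ‖z‖ < 1}

/-- A `(0,1)`-form `α₁ dz̄₁ + α₂ dz̄₂` in two complex variables, given by its coefficients:
`α 0` is the coefficient of `dz̄₁` and `α 1` is the coefficient of `dz̄₂`. Only the values on the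
domain under consideration are relevant. -/
abbrev Form01 : Type := Fin 2 → ℂ × ℂ → ℂ

/-- The coordinate vectors `(1, 0)` and `(0, 1)`. -/
def coordVec : Fin 2 → ℂ × ℂ := ![(1, 0), (0, 1)]

/-- The classical derivative `∂φ/∂z̄ⱼ = (∂φ/∂xⱼ + i ∂φ/∂yⱼ) / 2` of a (smooth) function; the index
`0` stands for the variable `z₁` and the index `1` for `z₂`. -/
def dbar (j : Fin 2) (φ : ℂ × ℂ → ℂ) (z : ℂ × ℂ) : ℂ :=
  (1 / 2) * (fderiv ℝ φ z (coordVec j) + I * fderiv ℝ φ z (I • coordVec j))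

/-- Test functions on `Ω`: complex valued, smooth in the real sense, with compact support
contained in `Ω`. -/
def IsTestFunction (Ω : Set (ℂ × ℂ)) (φ : ℂ × ℂ → ℂ) : Prop :=
  ContDiff ℝ ∞ φ ∧ HasCompactSupport φ ∧ tsupport φ ⊆ Ω

/-- `g = ∂u/∂z̄ⱼ` on the open set `Ω` in the weak (distributional) sense. -/
def HasWeakDbar (Ω : Set (ℂ × ℂ)) (j : Fin 2) (u g : ℂ × ℂ → ℂ) : Prop :=
  LocallyIntegrableOn u Ω ∧ LocallyIntegrableOn g Ω ∧
    ∀ φ, IsTestFunction Ω φ → ∫ z in Ω, u z * dbar j φ z = -∫ z in Ω, g z * φ z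

/-- `v` is a weak solution of `∂̄v = α` on `Ω`. -/
def IsWeakSolution (Ω : Set (ℂ × ℂ)) (v : ℂ × ℂ → ℂ) (α : Form01) : Prop :=
  ∀ j, HasWeakDbar Ω j v (α j)

/-- `α` is `∂̄`-closed on `Ω` in the weak sense: `∂α₁/∂z̄₂ = ∂α₂/∂z̄₁` as distributions. -/
def IsWeaklyDbarClosed (Ω : Set (ℂ × ℂ)) (α : Form01) : Prop :=
  (∀ j, LocallyIntegrableOn (α j) Ω) ∧
    ∀ φ, IsTestFunction Ω φ → ∫ z in Ω, α 0 z * dbar 1 φ z = ∫ z in Ω, α 1 z * dbar 0 φ z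

/-- The function `g` represents the distribution `𝒟f = (∂f₁/∂z̄₂ + ∂f₂/∂z̄₁) / 2` on `Ω`. -/
def IsScriptD (Ω : Set (ℂ × ℂ)) (f : Form01) (g : ℂ × ℂ → ℂ) : Prop :=
  (∀ j, LocallyIntegrableOn (f j) Ω) ∧ LocallyIntegrableOn g Ω ∧
    ∀ φ, IsTestFunction Ω φ →
      (1 / 2) * ((∫ z in Ω, f 0 z * dbar 1 φ z) + ∫ z in Ω, f 1 z * dbar 0 φ z)
        = -∫ z in Ω, g z * φ z

open Classical in
/-- `𝒟f` on `Ω`, as a function (determined almost everywhere on `Ω`); it has no meaning unless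
the distribution `𝒟f` is given by a locally integrable function. -/
def scriptD (Ω : Set (ℂ × ℂ)) (f : Form01) : ℂ × ℂ → ℂ :=
  if h : ∃ g, IsScriptD Ω f g then h.choose else 0

/-- `f ∈ 𝓑`: the coefficients of `f` are in `L^p(Ω)` and `𝒟f` is given by a function in `L^p(Ω)`. -/
def MemB (Ω : Set (ℂ × ℂ)) (p : ℝ≥0∞) (f : Form01) : Prop :=
  (∀ j, MemLp (f j) p (volume.restrict Ω)) ∧
    IsScriptD Ω f (scriptD Ω f) ∧ MemLp (scriptD Ω f) p (volume.restrict Ω)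

/-- The integral operator `T` on `𝔻 × 𝔻*`. In each variable `dζ̄ ∧ dζ = 2i dA(ζ)` with `dA` the
Lebesgue measure, which is the origin of the factors `2 * I`. -/
def T (f : Form01) (w : ℂ × ℂ) : ℂ :=
  (-1 / (2 * Real.pi * I)) * (∫ ζ in puncDisc, f 1 (w.1, ζ) / (ζ - w.2) * (2 * I))
  + (-1 / (2 * Real.pi * I)) * (∫ ζ in disc, f 0 (ζ, w.2) / (ζ - w.1) * (2 * I))
  + (-1 / (2 * Real.pi * I) ^ 2) *
      (∫ ζ in disc ×ˢ puncDisc,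
        scriptD (disc ×ˢ puncDisc) f ζ / ((ζ.1 - w.1) * (ζ.2 - w.2)) * ((2 * I) * (2 * I)))

/-- The three integrals that define `T f` converge absolutely at the point `w`. -/
def TConverges (f : Form01) (w : ℂ × ℂ) : Prop :=
  IntegrableOn (fun ζ => f 1 (w.1, ζ) / (ζ - w.2)) puncDisc ∧
  IntegrableOn (fun ζ => f 0 (ζ, w.2) / (ζ - w.1)) disc ∧
  IntegrableOn (fun ζ : ℂ × ℂ =>
    scriptD (disc ×ˢ puncDisc) f ζ / ((ζ.1 - w.1) * (ζ.2 - w.2))) (disc ×ˢ puncDisc)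

/-- The biholomorphism `φ(z₁, z₂) = (z₁ / z₂, z₂)` of the Hartogs triangle onto `𝔻 × 𝔻*`. -/
def phi (z : ℂ × ℂ) : ℂ × ℂ := (z.1 / z.2, z.2)

/-- The inverse `φ⁻¹(w₁, w₂) = (w₁ w₂, w₂)`. -/
def phiInv (w : ℂ × ℂ) : ℂ × ℂ := (w.1 * w.2, w.2)

/-- The pulled-back form `f = (φ⁻¹)^* α` on `𝔻 × 𝔻*`:
`f₁ = w̄₂ (α₁ ∘ φ⁻¹)` and `f₂ = w̄₁ (α₁ ∘ φ⁻¹) + α₂ ∘ φ⁻¹`. -/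
def pullback (α : Form01) : Form01 :=
  ![fun w => conj w.2 * α 0 (phiInv w),
    fun w => conj w.1 * α 0 (phiInv w) + α 1 (phiInv w)]

/-- The measure `|z₂|^s dV` on the Hartogs triangle; `L^p_s` is the `L^p` space of this measure. -/
def weighted (s : ℝ) : Measure (ℂ × ℂ) :=
  (volume.restrict hartogs).withDensity fun z => ENNReal.ofReal (‖z.2‖ ^ s)

end HartogsDbar

end

/-! The map `phi` replaces the singular domain by the product 𝔻 × 𝔻*, on which ∂̄ is solved by
one-variable Cauchy transforms. Let C₁, C₂ denote integration against 1/(ζ - w) in the first and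
second variable and let g = 𝒟f. Then T f = -(C₂f₂ + C₁f₁)/π - C₁C₂g/π². Closedness of α gives
∂f₁/∂w̄₂ = ∂f₂/∂w̄₁ = g. By Cauchy–Pompeiu (`integral_dbarDir_mul_cauchyKernel`) ∂/∂w̄ⱼ undoes
-Cⱼ/π, and ∂/∂w̄₁ passes through C₂. Hence ∂(Tf)/∂w̄₁ = -C₂g/π + f₁ + C₂g/π = f₁; the other variable
is symmetric because C₁C₂ = C₂C₁ almost everywhere. Everything is read weakly, by pairing with test
functions (`isWeakSolution_solOp`).

The L^p bound on the product is Schur's test: 1/(ζ - w) has uniformly bounded L¹ norm on the disc in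
either variable, so each Cⱼ is bounded on L^p for all finite p ≥ 1. The measures are finite, so L^p
data are integrable and Fubini is available.

The weights come from the change of variables. The real Jacobian of `phiInv` is |w₂|², so Lebesgue
measure on 𝔻 × 𝔻* corresponds to |z₂|⁻² dV (`measurePreserving_phiInv`). Here g = w̄₂(w̄₁ ∂α₁/∂z̄₁ +
∂α₁/∂z̄₂) + α₁, composed with `phiInv`. The factor w̄₂ improves the weight on the derivatives to
|z₂|^(p-2) ≤ |z₂|⁻¹, which is why L^p_{-1} suffices for them while the coefficients need L^p_{-2}.
Finally dV ≤ |z₂|⁻² dV on the Hartogs triangle, which brings the estimate for v back. -/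

namespace HartogsDbar

/-! ### Integral operators with a Schur kernel in one variable of a product. -/

section SchurKernel

variable {X : Type*} [MeasurableSpace X]

/-- A measurable kernel all of whose sections have `L¹` norm at most `A`. -/
structure SchurKernel (m : Measure X) (K : X → X → ℂ) (A : ℝ≥0) : Prop where
  measurable : Measurable (Function.uncurry K)
  left : ∀ w, ∫⁻ ζ, ‖K ζ w‖ₑ ∂m ≤ A
  right : ∀ ζ, ∫⁻ w, ‖K ζ w‖ₑ ∂m ≤ A

/-- The integral operator with kernel `K`, acting on the second variable. -/
noncomputable def sndOp (m : Measure X) (K : X → X → ℂ) (F : X × X → ℂ) (w : X × X) : ℂ :=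
  ∫ ζ, F (w.1, ζ) * K ζ w.2 ∂m

/-- The integral operator with kernel `K`, acting on the first variable. -/
noncomputable def fstOp (m : Measure X) (K : X → X → ℂ) (F : X × X → ℂ) (w : X × X) : ℂ :=
  ∫ ζ, F (ζ, w.2) * K ζ w.1 ∂m

variable {m : Measure X} {K : X → X → ℂ} {A : ℝ≥0}

theorem fstOp_eq_swap (F : X × X → ℂ) :
    fstOp m K F = sndOp m K (F ∘ Prod.swap) ∘ Prod.swap := rfl

/-- Integrability of a function against a Schur kernel in an additional variable. -/
theorem SchurKernel.integrable_mul {Y : Type*} [MeasurableSpace Y] {μ : Measure Y} [SFinite μ]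
    [SFinite m] (hK : SchurKernel m K A) {F : Y → ℂ} (hF : Integrable F μ) {g : Y → X}
    (hg : Measurable g) : Integrable (fun q : Y × X => F q.1 * K (g q.1) q.2) (μ.prod m) := by
  have hKm : Measurable (fun q : Y × X => K (g q.1) q.2) :=
    hK.measurable.comp ((hg.comp measurable_fst).prodMk measurable_snd)
  have hm : AEStronglyMeasurable (fun q : Y × X => F q.1 * K (g q.1) q.2) (μ.prod m) :=
    hF.1.comp_fst.mul hKm.aestronglyMeasurable
  refine ⟨hm, ?_⟩
  rw [hasFiniteIntegral_iff_enorm, lintegral_prod _ hm.enorm]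
  calc ∫⁻ y, ∫⁻ x, ‖F y * K (g y) x‖ₑ ∂m ∂μ ≤ ∫⁻ y, ‖F y‖ₑ * A ∂μ := by
        refine lintegral_mono fun y => ?_
        simp only [enorm_mul]
        rw [lintegral_const_mul' _ _ enorm_ne_top]
        gcongr
        exact hK.right _
    _ = (∫⁻ y, ‖F y‖ₑ ∂μ) * A := lintegral_mul_const' _ _ ENNReal.coe_ne_top
    _ < ⊤ := ENNReal.mul_lt_top hF.2 ENNReal.coe_lt_top

/-- Jensen's inequality for the weight `κ`. -/
theorem lintegral_mul_rpow_le {h κ : X → ℝ≥0∞} (hh : AEMeasurable h m) (hκ : Measurable κ)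
    {p : ℝ} (hp : 1 ≤ p) :
    (∫⁻ x, h x * κ x ∂m) ^ p ≤ (∫⁻ x, κ x ∂m) ^ (p - 1) * ∫⁻ x, h x ^ p * κ x ∂m := by
  rcases hp.eq_or_lt with rfl | hp1
  · simp
  have hpq := Real.HolderConjugate.conjExponent hp1
  set q := p.conjExponent
  have hp0 : 0 < p := by linarith
  have hq0 : 0 < q := hpq.symm.pos
  have hpq1 : 1 / p + 1 / q = 1 := by simpa using hpq.inv_add_inv_eq_one
  have hqp : 1 / q * p = p - 1 := by
    have : 1 / q = 1 - 1 / p := by linarith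
    rw [this]
    field_simp
  -- Hölder with κ split as κ^(1/p) κ^(1/q), so that h is integrated against κ itself.
  have e : ∀ x, h x * κ x = ((fun x => h x * κ x ^ (1 / p)) * fun x => κ x ^ (1 / q)) x := by
    intro x
    rw [Pi.mul_apply, mul_assoc, ← ENNReal.rpow_add_of_nonneg _ _ (by positivity) (by positivity),
      hpq1, ENNReal.rpow_one]
  have hold := ENNReal.lintegral_mul_le_Lp_mul_Lq m hpq
    (hh.mul (hκ.aemeasurable.pow_const (1 / p))) (hκ.aemeasurable.pow_const (1 / q))
  calc (∫⁻ x, h x * κ x ∂m) ^ p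
      ≤ ((∫⁻ x, (h x * κ x ^ (1 / p)) ^ p ∂m) ^ (1 / p) *
          (∫⁻ x, (κ x ^ (1 / q)) ^ q ∂m) ^ (1 / q)) ^ p := by
        simp only [e]
        exact ENNReal.rpow_le_rpow hold hp0.le
    _ = _ := by
        rw [ENNReal.mul_rpow_of_nonneg _ _ hp0.le, ← ENNReal.rpow_mul, ← ENNReal.rpow_mul, hqp,
          one_div_mul_cancel hp0.ne', ENNReal.rpow_one, mul_comm]
        simp only [ENNReal.mul_rpow_of_nonneg _ _ hp0.le, ← ENNReal.rpow_mul,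
          one_div_mul_cancel hp0.ne', one_div_mul_cancel hq0.ne', ENNReal.rpow_one]

variable [IsFiniteMeasure m]

/-- Exchanging the integration variable ζ with w₂ turns F(w₁, ζ) K(ζ, w₂) into F at the base point
times a kernel in the extra variable. Both integrability and the transposition formula reduce to
this exchange. -/
theorem measurePreserving_swap_snd :
    MeasurePreserving (fun q : (X × X) × X => ((q.1.1, q.2), q.1.2))
      ((m.prod m).prod m) ((m.prod m).prod m) :=
  ((measurePreserving_prodAssoc m m m).symm _).comp
    (((MeasurePreserving.id m).prod Measure.measurePreserving_swap).comp
      (measurePreserving_prodAssoc m m m))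

theorem SchurKernel.integrable_snd (hK : SchurKernel m K A) {F : X × X → ℂ}
    (hF : Integrable F (m.prod m)) :
    Integrable (fun q : (X × X) × X => F (q.1.1, q.2) * K q.2 q.1.2) ((m.prod m).prod m) :=
  measurePreserving_swap_snd.integrable_comp_of_integrable
    (hK.integrable_mul hF (g := Prod.snd) measurable_snd)

theorem SchurKernel.ae_integrable_snd (hK : SchurKernel m K A) {F : X × X → ℂ}
    (hF : Integrable F (m.prod m)) :
    ∀ᵐ w ∂(m.prod m), Integrable (fun ζ => F (w.1, ζ) * K ζ w.2) m :=
  (hK.integrable_snd hF).prod_right_ae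

theorem SchurKernel.integrable_sndOp (hK : SchurKernel m K A) {F : X × X → ℂ}
    (hF : Integrable F (m.prod m)) : Integrable (sndOp m K F) (m.prod m) :=
  (hK.integrable_snd hF).integral_prod_left

theorem SchurKernel.ae_integrable_fst (hK : SchurKernel m K A) {F : X × X → ℂ}
    (hF : Integrable F (m.prod m)) :
    ∀ᵐ w ∂(m.prod m), Integrable (fun ζ => F (ζ, w.2) * K ζ w.1) m :=
  Measure.measurePreserving_swap.quasiMeasurePreserving.ae (hK.ae_integrable_snd hF.swap)

theorem SchurKernel.integrable_fstOp (hK : SchurKernel m K A) {F : X × X → ℂ}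
    (hF : Integrable F (m.prod m)) : Integrable (fstOp m K F) (m.prod m) :=
  (hK.integrable_sndOp hF.swap).swap

/-- The pairing of `sndOp F` with a bounded function is the pairing of `F` with the transpose. -/
theorem SchurKernel.integral_sndOp_mul (hK : SchurKernel m K A) {F ψ : X × X → ℂ}
    (hF : Integrable F (m.prod m)) (hψ : Measurable ψ) {c : ℝ} (hc : ∀ w, ‖ψ w‖ ≤ c) :
    ∫ w, sndOp m K F w * ψ w ∂(m.prod m) =
      ∫ w, F w * ∫ η, ψ (w.1, η) * K w.2 η ∂m ∂(m.prod m) := by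
  have hint : Integrable (fun q : (X × X) × X => F (q.1.1, q.2) * K q.2 q.1.2 * ψ q.1)
      ((m.prod m).prod m) :=
    (hK.integrable_snd hF).mul_bdd (c := c) (hψ.comp measurable_fst).aestronglyMeasurable
      (.of_forall fun q => hc _)
  have hint' : Integrable (fun q : (X × X) × X => F q.1 * K q.1.2 q.2 * ψ (q.1.1, q.2))
      ((m.prod m).prod m) :=
    measurePreserving_swap_snd.integrable_comp_of_integrable hint
  calc ∫ w, sndOp m K F w * ψ w ∂(m.prod m)
      = ∫ w, ∫ ζ, F (w.1, ζ) * K ζ w.2 * ψ w ∂m ∂(m.prod m) := by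
        simp only [sndOp, integral_mul_const]
    _ = ∫ q : (X × X) × X, F (q.1.1, q.2) * K q.2 q.1.2 * ψ q.1 ∂((m.prod m).prod m) :=
        (integral_prod _ hint).symm
    _ = ∫ q : (X × X) × X, F q.1 * K q.1.2 q.2 * ψ (q.1.1, q.2) ∂((m.prod m).prod m) := by
        have h := integral_map (μ := (m.prod m).prod m)
          (measurePreserving_swap_snd (m := m)).measurable.aemeasurable
          (f := fun q : (X × X) × X => F (q.1.1, q.2) * K q.2 q.1.2 * ψ q.1)
          (by rw [measurePreserving_swap_snd.map_eq]; exact hint.1)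
        rw [measurePreserving_swap_snd.map_eq] at h
        exact h
    _ = ∫ w, ∫ η, F w * K w.2 η * ψ (w.1, η) ∂m ∂(m.prod m) := integral_prod _ hint'
    _ = _ := by
        refine integral_congr_ae (.of_forall fun w => ?_)
        simp only [← integral_const_mul]
        exact integral_congr_ae (.of_forall fun η => by ring)

/-- If the transpose of the operator maps `ψ'` to `c ψ`, then the pairing of `sndOp F` with `ψ'`
is `c` times the pairing of `F` with `ψ`. -/
theorem SchurKernel.integral_sndOp_mul_of_inverse (hK : SchurKernel m K A) {F ψ ψ' : X × X → ℂ}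
    (hF : Integrable F (m.prod m)) (hψ' : Measurable ψ') {b : ℝ} (hb : ∀ w, ‖ψ' w‖ ≤ b) {c : ℂ}
    (hinv : ∀ a ζ, ∫ η, ψ' (a, η) * K ζ η ∂m = c * ψ (a, ζ)) :
    ∫ w, sndOp m K F w * ψ' w ∂(m.prod m) = c * ∫ w, F w * ψ w ∂(m.prod m) := by
  rw [hK.integral_sndOp_mul hF hψ' hb, ← integral_const_mul]
  refine integral_congr_ae (.of_forall fun w => ?_)
  simp only [hinv, Prod.mk.eta]
  ring

theorem SchurKernel.integral_fstOp_mul_of_inverse (hK : SchurKernel m K A) {F ψ ψ' : X × X → ℂ}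
    (hF : Integrable F (m.prod m)) (hψ' : Measurable ψ') {b : ℝ} (hb : ∀ w, ‖ψ' w‖ ≤ b) {c : ℂ}
    (hinv : ∀ a ζ, ∫ η, ψ' (η, a) * K ζ η ∂m = c * ψ (ζ, a)) :
    ∫ w, fstOp m K F w * ψ' w ∂(m.prod m) = c * ∫ w, F w * ψ w ∂(m.prod m) := by
  have h := hK.integral_sndOp_mul_of_inverse (ψ := ψ ∘ Prod.swap) hF.swap
    (hψ'.comp measurable_swap) (fun w => hb w.swap) (c := c) hinv
  rw [← integral_prod_swap, ← integral_prod_swap (f := fun w => F w * ψ w)]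
  exact h

/-- The pairing of `sndOp F` with `ψ'`, computed with the second variable of `ψ'` frozen. -/
theorem SchurKernel.integral_sndOp_mul_eq (hK : SchurKernel m K A) {F ψ : X × X → ℂ}
    (hF : Integrable F (m.prod m)) (hψ : Measurable ψ) {c : ℝ} (hc : ∀ w, ‖ψ w‖ ≤ c) :
    ∫ w, sndOp m K F w * ψ w ∂(m.prod m) =
      ∫ b, ∫ ζ, (∫ a, F (a, ζ) * ψ (a, b) ∂m) * K ζ b ∂m ∂m := by
  have hint : Integrable (fun q : (X × X) × X => F (q.1.1, q.2) * K q.2 q.1.2 * ψ q.1)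
      ((m.prod m).prod m) :=
    (hK.integrable_snd hF).mul_bdd (c := c) (hψ.comp measurable_fst).aestronglyMeasurable
      (.of_forall fun q => hc _)
  have hint2 : Integrable (fun q : X × (X × X) => F (q.1, q.2.2) * K q.2.2 q.2.1 * ψ (q.1, q.2.1))
      (m.prod (m.prod m)) :=
    ((measurePreserving_prodAssoc m m m).symm _).integrable_comp_of_integrable hint
  calc ∫ w, sndOp m K F w * ψ w ∂(m.prod m)
      = ∫ w, ∫ ζ, F (w.1, ζ) * K ζ w.2 * ψ w ∂m ∂(m.prod m) := by
        simp only [sndOp, integral_mul_const]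
    _ = ∫ q : (X × X) × X, F (q.1.1, q.2) * K q.2 q.1.2 * ψ q.1 ∂((m.prod m).prod m) :=
        (integral_prod _ hint).symm
    _ = ∫ q : X × (X × X), F (q.1, q.2.2) * K q.2.2 q.2.1 * ψ (q.1, q.2.1)
          ∂(m.prod (m.prod m)) :=
        (((measurePreserving_prodAssoc m m m).symm _).integral_comp
          MeasurableEquiv.prodAssoc.symm.measurableEmbedding
          (fun q : (X × X) × X => F (q.1.1, q.2) * K q.2 q.1.2 * ψ q.1)).symm
    _ = ∫ w : X × X, ∫ a, F (a, w.2) * K w.2 w.1 * ψ (a, w.1) ∂m ∂(m.prod m) :=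
        integral_prod_symm _ hint2
    _ = ∫ b, ∫ ζ, ∫ a, F (a, ζ) * K ζ b * ψ (a, b) ∂m ∂m ∂m :=
        integral_prod _ hint2.integral_prod_right
    _ = _ := by
        simp only [← integral_mul_const]
        refine integral_congr_ae (.of_forall fun b => integral_congr_ae (.of_forall fun ζ =>
          integral_congr_ae (.of_forall fun a => ?_)))
        simp only
        ring

/-- This lets a weak derivative in the first variable pass through an operator acting in the second:
once b and ζ are frozen, only the inner integral over a involves ψ and ψ'. The exceptional set of ζ
may depend on b, since b is integrated last. -/
theorem SchurKernel.integral_sndOp_mul_congr (hK : SchurKernel m K A) {F G ψ ψ' : X × X → ℂ}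
    (hF : Integrable F (m.prod m)) (hG : Integrable G (m.prod m))
    (hψ : Measurable ψ) {c : ℝ} (hc : ∀ w, ‖ψ w‖ ≤ c)
    (hψ' : Measurable ψ') {c' : ℝ} (hc' : ∀ w, ‖ψ' w‖ ≤ c')
    (h : ∀ b, ∀ᵐ ζ ∂m, ∫ a, F (a, ζ) * ψ' (a, b) ∂m = -∫ a, G (a, ζ) * ψ (a, b) ∂m) :
    ∫ w, sndOp m K F w * ψ' w ∂(m.prod m) = -∫ w, sndOp m K G w * ψ w ∂(m.prod m) := by
  rw [hK.integral_sndOp_mul_eq hF hψ' hc', hK.integral_sndOp_mul_eq hG hψ hc, ← integral_neg]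
  refine integral_congr_ae (.of_forall fun b => ?_)
  simp only [← integral_neg]
  refine integral_congr_ae ?_
  filter_upwards [h b] with ζ hζ
  rw [hζ, neg_mul]

theorem SchurKernel.integral_fstOp_mul_congr (hK : SchurKernel m K A) {F G ψ ψ' : X × X → ℂ}
    (hF : Integrable F (m.prod m)) (hG : Integrable G (m.prod m))
    (hψ : Measurable ψ) {c : ℝ} (hc : ∀ w, ‖ψ w‖ ≤ c)
    (hψ' : Measurable ψ') {c' : ℝ} (hc' : ∀ w, ‖ψ' w‖ ≤ c')
    (h : ∀ b, ∀ᵐ ζ ∂m, ∫ a, F (ζ, a) * ψ' (b, a) ∂m = -∫ a, G (ζ, a) * ψ (b, a) ∂m) :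
    ∫ w, fstOp m K F w * ψ' w ∂(m.prod m) = -∫ w, fstOp m K G w * ψ w ∂(m.prod m) := by
  have h := hK.integral_sndOp_mul_congr hF.swap hG.swap (hψ.comp measurable_swap)
    (fun w => hc w.swap) (hψ'.comp measurable_swap) (fun w => hc' w.swap) h
  rw [← integral_prod_swap, ← integral_prod_swap (f := fun w => fstOp m K G w * ψ w)]
  exact h

/-- Almost everywhere absolute convergence of the double integral. -/
theorem SchurKernel.ae_integrable_prod (hK : SchurKernel m K A) {F : X × X → ℂ}
    (hF : Integrable F (m.prod m)) :
    ∀ᵐ w ∂(m.prod m), Integrable (fun ζ : X × X => F ζ * (K ζ.1 w.1 * K ζ.2 w.2)) (m.prod m) := by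
  -- The two kernels are attached one at a time, each with its own new variable; freezing these
  -- variables afterwards gives the claim.
  have h1 := hK.integrable_mul hF (g := Prod.fst) measurable_fst
  have h2 := hK.integrable_mul h1 (g := fun q : (X × X) × X => q.1.2) (by fun_prop)
  have h3 : Integrable (fun q : (X × X) × (X × X) => F q.1 * K q.1.1 q.2.1 * K q.1.2 q.2.2)
      ((m.prod m).prod (m.prod m)) :=
    ((measurePreserving_prodAssoc (m.prod m) m m).symm _).integrable_comp_of_integrable h2
  filter_upwards [h3.prod_left_ae] with w hw
  exact hw.congr (.of_forall fun ζ => by simp only; ring)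

theorem integral_prod_eq_fstOp_sndOp {F : X × X → ℂ} {w : X × X}
    (h : Integrable (fun ζ : X × X => F ζ * (K ζ.1 w.1 * K ζ.2 w.2)) (m.prod m)) :
    ∫ ζ : X × X, F ζ * (K ζ.1 w.1 * K ζ.2 w.2) ∂(m.prod m) = fstOp m K (sndOp m K F) w := by
  rw [integral_prod _ h]
  refine integral_congr_ae (.of_forall fun a => ?_)
  simp only [sndOp, ← integral_mul_const]
  exact integral_congr_ae (.of_forall fun ζ => by simp only; ring)

theorem integral_prod_eq_sndOp_fstOp {F : X × X → ℂ} {w : X × X}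
    (h : Integrable (fun ζ : X × X => F ζ * (K ζ.1 w.1 * K ζ.2 w.2)) (m.prod m)) :
    ∫ ζ : X × X, F ζ * (K ζ.1 w.1 * K ζ.2 w.2) ∂(m.prod m) = sndOp m K (fstOp m K F) w := by
  rw [integral_prod_symm _ h]
  refine integral_congr_ae (.of_forall fun a => ?_)
  simp only [fstOp, ← integral_mul_const]
  exact integral_congr_ae (.of_forall fun ζ => by simp only; ring)

/-- Schur's test in one variable. -/
theorem SchurKernel.lintegral_rpow_le (hK : SchurKernel m K A) {h : X → ℝ≥0∞}
    (hh : AEMeasurable h m) {p : ℝ} (hp : 1 ≤ p) :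
    ∫⁻ w, (∫⁻ ζ, h ζ * ‖K ζ w‖ₑ ∂m) ^ p ∂m ≤ (A : ℝ≥0∞) ^ p * ∫⁻ ζ, h ζ ^ p ∂m := by
  have hKm : Measurable (fun q : X × X => ‖K q.2 q.1‖ₑ) :=
    (hK.measurable.comp measurable_swap).enorm
  calc ∫⁻ w, (∫⁻ ζ, h ζ * ‖K ζ w‖ₑ ∂m) ^ p ∂m
      ≤ ∫⁻ w, (A : ℝ≥0∞) ^ (p - 1) * ∫⁻ ζ, h ζ ^ p * ‖K ζ w‖ₑ ∂m ∂m := by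
        refine lintegral_mono fun w => (lintegral_mul_rpow_le hh
          (hKm.comp measurable_prodMk_left) hp).trans ?_
        exact mul_le_mul' (ENNReal.rpow_le_rpow (hK.left w) (by linarith)) le_rfl
    _ = (A : ℝ≥0∞) ^ (p - 1) * ∫⁻ ζ, ∫⁻ w, h ζ ^ p * ‖K ζ w‖ₑ ∂m ∂m := by
        rw [lintegral_const_mul' _ _ (ENNReal.rpow_ne_top_of_nonneg (by linarith)
          ENNReal.coe_ne_top), lintegral_lintegral_swap]
        exact ((hh.pow_const p).comp_snd).mul hKm.aemeasurable
    _ ≤ (A : ℝ≥0∞) ^ (p - 1) * ∫⁻ ζ, h ζ ^ p * A ∂m := by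
        gcongr with ζ
        rw [lintegral_const_mul]
        · gcongr
          exact hK.right ζ
        · exact hKm.comp measurable_prodMk_right
    _ = _ := by
        rw [lintegral_mul_const' _ _ ENNReal.coe_ne_top, mul_comm _ (A : ℝ≥0∞), ← mul_assoc]
        congr 1
        nth_rw 2 [← ENNReal.rpow_one (A : ℝ≥0∞)]
        rw [← ENNReal.rpow_add_of_nonneg _ _ (by linarith) zero_le_one, sub_add_cancel]

theorem SchurKernel.eLpNorm_sndOp_le (hK : SchurKernel m K A) {F : X × X → ℂ}
    (hF : Integrable F (m.prod m)) {p : ℝ≥0∞} (hp : 1 ≤ p) (hp' : p ≠ ⊤) :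
    eLpNorm (sndOp m K F) p (m.prod m) ≤ A * eLpNorm F p (m.prod m) := by
  have hp0 : p ≠ 0 := (zero_lt_one.trans_le hp).ne'
  have hp1 : 1 ≤ p.toReal := by simpa using ENNReal.toReal_mono hp' hp
  rw [eLpNorm_eq_lintegral_rpow_enorm_toReal hp0 hp', eLpNorm_eq_lintegral_rpow_enorm_toReal hp0 hp']
  have key : ∫⁻ w, ‖sndOp m K F w‖ₑ ^ p.toReal ∂(m.prod m) ≤
      (A : ℝ≥0∞) ^ p.toReal * ∫⁻ w, ‖F w‖ₑ ^ p.toReal ∂(m.prod m) := by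
    rw [lintegral_prod _ ((hK.integrable_sndOp hF).1.enorm.pow_const _),
      lintegral_prod _ (hF.1.enorm.pow_const _), ← lintegral_const_mul' _ _
      (ENNReal.rpow_ne_top_of_nonneg (by linarith) ENNReal.coe_ne_top)]
    -- The first variable is only a parameter, so the one-variable Schur test applies on almost
    -- every slice.
    refine lintegral_mono_ae ?_
    filter_upwards [hF.prod_right_ae] with a ha
    refine le_trans ?_ (hK.lintegral_rpow_le ha.1.enorm hp1)
    gcongr with w
    refine (enorm_integral_le_lintegral_enorm _).trans_eq ?_
    simp only [enorm_mul]
  calc _ ≤ ((A : ℝ≥0∞) ^ p.toReal * ∫⁻ w, ‖F w‖ₑ ^ p.toReal ∂(m.prod m)) ^ (1 / p.toReal) := by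
        gcongr
    _ = _ := by
        rw [ENNReal.mul_rpow_of_nonneg _ _ (by positivity), ← ENNReal.rpow_mul,
          mul_one_div_cancel (by linarith), ENNReal.rpow_one]

theorem SchurKernel.eLpNorm_fstOp_le (hK : SchurKernel m K A) {F : X × X → ℂ}
    (hF : Integrable F (m.prod m)) {p : ℝ≥0∞} (hp : 1 ≤ p) (hp' : p ≠ ⊤) :
    eLpNorm (fstOp m K F) p (m.prod m) ≤ A * eLpNorm F p (m.prod m) := by
  have hs := Measure.measurePreserving_swap (μ := m) (ν := m)
  rw [fstOp_eq_swap, eLpNorm_comp_measurePreserving (hK.integrable_sndOp hF.swap).1 hs,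
    ← eLpNorm_comp_measurePreserving hF.1 hs]
  exact hK.eLpNorm_sndOp_le hF.swap hp hp'

end SchurKernel

/-! ### The Cauchy kernel and the Cauchy–Pompeiu formula. -/

/-- The Cauchy kernel. -/
noncomputable def cauchyKernel (ζ w : ℂ) : ℂ := (ζ - w)⁻¹

theorem lintegral_inv_ball_lt_top :
    ∫⁻ x in Metric.ball (0 : ℂ) 1, ‖x⁻¹‖ₑ < ⊤ := by
  have h : IntegrableOn (fun x : ℂ => x⁻¹) (Metric.ball 0 1) volume := by
    refine integrableOn_ball_of_norm_le_rpow (C := 1) (α := 1) (by simp) (by simp) ?_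
      measurable_inv.aestronglyMeasurable
    exact .of_forall fun x => by rw [norm_inv, Real.rpow_neg_one, one_mul]
  exact h.2

theorem isOpen_disc : IsOpen disc := isOpen_lt continuous_norm continuous_const

theorem disc_eq_ball : disc = Metric.ball 0 1 := by
  ext z
  simp [disc]

instance isFiniteMeasure_disc : IsFiniteMeasure (volume.restrict disc) :=
  ⟨by rw [Measure.restrict_apply_univ, disc_eq_ball]; exact measure_ball_lt_top⟩

/-- The singular part of 1/|x|, cut off at radius 1, is integrable in the plane and its integral is
translation invariant; the rest is at most 1. Hence the bound does not depend on w. -/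
theorem lintegral_cauchyKernel_le (w : ℂ) :
    ∫⁻ ζ in disc, ‖cauchyKernel ζ w‖ₑ ≤
      (∫⁻ x in Metric.ball (0 : ℂ) 1, ‖x⁻¹‖ₑ) + volume disc := by
  set f : ℂ → ℝ≥0∞ := (Metric.ball (0 : ℂ) 1).indicator fun x => ‖x⁻¹‖ₑ
  have hf : ∀ x : ℂ, ‖x⁻¹‖ₑ ≤ f x + 1 := by
    intro x
    by_cases hx : x ∈ Metric.ball (0 : ℂ) 1
    · simp [f, hx]
    · have : ‖x⁻¹‖ ≤ 1 := by
        rw [norm_inv]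
        exact inv_le_one_of_one_le₀ (by simpa using hx)
      refine le_add_left ?_
      rw [← ofReal_norm, ← ENNReal.ofReal_one]
      exact ENNReal.ofReal_le_ofReal this
  have hfm : Measurable f := measurable_inv.enorm.indicator measurableSet_ball
  calc ∫⁻ ζ in disc, ‖cauchyKernel ζ w‖ₑ ≤ ∫⁻ ζ in disc, (f (ζ - w) + 1) :=
        lintegral_mono fun ζ => hf _
    _ = (∫⁻ ζ in disc, f (ζ - w)) + volume disc := by
        rw [lintegral_add_right _ measurable_const]
        simp
    _ ≤ (∫⁻ ζ, f (ζ - w)) + volume disc := by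
        gcongr
        exact Measure.restrict_le_self
    _ = _ := by
        rw [lintegral_sub_right_eq_self f w, lintegral_indicator measurableSet_ball]

theorem exists_schurKernel_cauchyKernel :
    ∃ A : ℝ≥0, SchurKernel (volume.restrict disc) cauchyKernel A := by
  have hfin : (∫⁻ x in Metric.ball (0 : ℂ) 1, ‖x⁻¹‖ₑ) + volume disc ≠ ⊤ := by
    refine (ENNReal.add_lt_top.2 ⟨lintegral_inv_ball_lt_top, ?_⟩).ne
    rw [disc_eq_ball]
    exact measure_ball_lt_top
  refine ⟨((∫⁻ x in Metric.ball (0 : ℂ) 1, ‖x⁻¹‖ₑ) + volume disc).toNNReal, ?_, fun w => ?_, fun ζ => ?_⟩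
  · exact (measurable_fst.sub measurable_snd).inv
  · rw [ENNReal.coe_toNNReal hfin]
    exact lintegral_cauchyKernel_le w
  · rw [ENNReal.coe_toNNReal hfin]
    refine le_trans (le_of_eq ?_) (lintegral_cauchyKernel_le ζ)
    refine lintegral_congr fun w => ?_
    rw [cauchyKernel, cauchyKernel, ← neg_sub, inv_neg, enorm_neg]

/-- The `∂̄`-derivative encoded by a real-linear map, in the direction `v`. -/
noncomputable def dbarDir {E : Type*} [NormedAddCommGroup E] [NormedSpace ℂ E] (D : E →L[ℝ] ℂ)
    (v : E) : ℂ := (1 / 2) * (D v + I * D (I • v))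

/-- The polar form ∂/∂z̄ = ½ e^{iθ}(∂_r + (i/r) ∂_θ): the differential applied to e^{iθ} is ∂_r, and
applied to i e^{iθ} it is (1/r) ∂_θ. -/
theorem dbarDir_one_mul_exp (D : ℂ →L[ℝ] ℂ) (θ : ℝ) :
    dbarDir D 1 = (1 / 2) * (D (exp (θ * I)) + I * D (exp (θ * I) * I)) * exp (θ * I) := by
  have h : ∀ x y : ℝ, D (x + y * I) = x * D 1 + y * D I := by
    intro x y
    have : (x + y * I : ℂ) = x • (1 : ℂ) + y • I := by simp
    rw [this, map_add, map_smul, map_smul, real_smul, real_smul]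
  have e : exp (θ * I) = (Real.cos θ : ℂ) + (Real.sin θ : ℂ) * I := by
    rw [exp_mul_I, ofReal_cos, ofReal_sin]
  have e' : exp (θ * I) * I = ((-Real.sin θ : ℝ) : ℂ) + (Real.cos θ : ℂ) * I := by
    rw [e]
    push_cast
    linear_combination (sin (θ : ℂ)) * I_sq
  rw [e', e, h, h, dbarDir, smul_eq_mul, mul_one]
  have hcs : (Real.cos θ : ℂ) ^ 2 + (Real.sin θ : ℂ) ^ 2 = 1 := by
    push_cast
    exact cos_sq_add_sin_sq _
  push_cast at hcs ⊢
  linear_combination (-1 / 2) * (D 1 + I * D I) * hcs +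
    (1 / 2) * ((sin (θ : ℂ)) ^ 2 * D 1 - sin (θ : ℂ) * cos (θ : ℂ) * D I) * I_sq

open Set in
/-- The Cauchy–Pompeiu formula for compactly supported functions. -/
theorem integral_dbarDir_mul_cauchyKernel {φ : ℂ → ℂ} (hφ : ContDiff ℝ 1 φ)
    (hc : HasCompactSupport φ) (ζ : ℂ) :
    ∫ η, dbarDir (fderiv ℝ φ η) 1 * cauchyKernel ζ η = Real.pi * φ ζ := by
  obtain ⟨R, hR0, hR⟩ := hc.isCompact.isBounded.exists_pos_norm_lt
  set D := fderiv ℝ φ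
  have hDc : Continuous D := hφ.continuous_fderiv one_ne_zero
  have hD0 : ∀ x, x ∉ tsupport φ → D x = 0 := fun x hx =>
    image_eq_zero_of_notMem_tsupport fun h => hx (tsupport_fderiv_subset ℝ h)
  let P : ℝ × ℝ → ℂ := fun q => ζ + q.1 * exp (q.2 * I)
  have hPc : Continuous P := by fun_prop
  have hPfar : ∀ q : ℝ × ℝ, R + ‖ζ‖ < |q.1| → P q ∉ tsupport φ := by
    intro q hq hmem
    have h1 := hR _ hmem
    have h2 : ‖(q.1 : ℂ) * exp (q.2 * I)‖ = |q.1| := by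
      rw [norm_mul, norm_exp_ofReal_mul_I, mul_one, norm_real, Real.norm_eq_abs]
    have h3 : ‖(q.1 : ℂ) * exp (q.2 * I)‖ ≤ ‖P q‖ + ‖ζ‖ := by
      have : (q.1 : ℂ) * exp (q.2 * I) = P q - ζ := by simp [P]
      rw [this]
      exact norm_sub_le _ _
    linarith
  let S : Set (ℝ × ℝ) := Ioi 0 ×ˢ Ioo (-Real.pi) Real.pi
  have hSm : MeasurableSet S := measurableSet_Ioi.prod measurableSet_Ioo
  -- V is a radial or angular direction field. The strip is unbounded, but the integrand vanishes
  -- for radius beyond R + ‖ζ‖.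
  have hint : ∀ V : ℝ → ℂ, Continuous V → IntegrableOn (fun q => D (P q) (V q.2)) S := by
    intro V hV
    have hcont : Continuous fun q : ℝ × ℝ => D (P q) (V q.2) :=
      (hDc.comp hPc).clm_apply (hV.comp continuous_snd)
    have hcpt : IsCompact (Icc (0 : ℝ) (R + ‖ζ‖) ×ˢ Icc (-Real.pi) Real.pi) :=
      isCompact_Icc.prod isCompact_Icc
    refine (hcont.continuousOn.integrableOn_compact hcpt).of_forall_sdiff_eq_zero hSm ?_
    rintro q ⟨⟨h1, h2⟩, h3⟩
    have : R + ‖ζ‖ < |q.1| := by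
      by_contra! h
      exact h3 ⟨⟨le_of_lt h1, (le_abs_self _).trans h⟩, Ioo_subset_Icc_self h2⟩
    simp [hD0 _ (hPfar q this)]
  have hA := hint (fun θ => exp (θ * I)) (by fun_prop)
  have hB := hint (fun θ => exp (θ * I) * I) (by fun_prop)
  have hradial : ∫ q in S, D (P q) (exp (q.2 * I)) = -(2 * Real.pi) * φ ζ := by
    have h1 : ∀ θ : ℝ, ∫ r in Ioi (0 : ℝ), D (P (r, θ)) (exp (θ * I)) = -φ ζ := by
      intro θ
      let u : ℝ → ℂ := fun r => φ (P (r, θ))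
      have hu : ContDiff ℝ 1 u := hφ.comp (by
        have : ContDiff ℝ 1 fun r : ℝ => (r : ℂ) := ofRealCLM.contDiff
        change ContDiff ℝ 1 fun r : ℝ => ζ + (r : ℂ) * exp (θ * I)
        exact contDiff_const.add (this.mul contDiff_const))
      have hus : HasCompactSupport u := by
        refine HasCompactSupport.intro (isCompact_Icc (a := -(R + ‖ζ‖)) (b := R + ‖ζ‖)) ?_
        intro r hr
        refine image_eq_zero_of_notMem_tsupport (f := φ) (hPfar (r, θ) ?_)
        by_contra! h
        exact hr (abs_le.1 h)
      have hd : ∀ r, deriv u r = D (P (r, θ)) (exp (θ * I)) := by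
        intro r
        have hP : HasDerivAt (fun r : ℝ => P (r, θ)) (exp (θ * I)) r := by
          have := ((hasDerivAt_id r).ofReal_comp.mul_const (exp (θ * I))).const_add ζ
          simpa [P] using this
        exact ((hφ.differentiable one_ne_zero _).hasFDerivAt.comp_hasDerivAt r hP).deriv
      have := hus.integral_Ioi_deriv_eq hu 0
      simp only [hd] at this
      rw [this]
      simp [u, P]
    have h2 : ∫ q in S, D (P q) (exp (q.2 * I)) =
        ∫ θ in Ioo (-Real.pi) Real.pi, ∫ r in Ioi (0 : ℝ), D (P (r, θ)) (exp (θ * I)) := by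
      have := hA
      rw [IntegrableOn, Measure.volume_eq_prod, ← Measure.prod_restrict] at this
      rw [Measure.volume_eq_prod, ← Measure.prod_restrict]
      exact integral_prod_symm _ this
    rw [h2]
    simp only [h1, integral_const, measureReal_restrict_apply_univ, Real.volume_real_Ioo]
    rw [max_eq_left (by linarith [Real.pi_pos]), real_smul]
    push_cast
    ring
  have hangular : ∫ q in S, D (P q) (exp (q.2 * I) * I) = 0 := by
    rw [Measure.volume_eq_prod, setIntegral_prod _ hB]
    refine integral_eq_zero_of_ae ?_
    filter_upwards [ae_restrict_mem measurableSet_Ioi] with r hr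
    have hr : (0 : ℝ) < r := hr
    have hd : ∀ θ : ℝ, HasDerivAt (fun θ : ℝ => φ (P (r, θ)))
        (r • D (P (r, θ)) (exp (θ * I) * I)) θ := by
      intro θ
      have hP : HasDerivAt (fun θ : ℝ => P (r, θ)) (r • (exp (θ * I) * I)) θ := by
        have h := (((hasDerivAt_id θ).ofReal_comp.mul_const I).cexp.const_mul (r : ℂ)).const_add ζ
        simpa [P] using h
      have := (hφ.differentiable one_ne_zero (P (r, θ))).hasFDerivAt.comp_hasDerivAt θ hP
      rw [map_smul] at this
      exact this
    have hcont : Continuous fun θ : ℝ => r • D (P (r, θ)) (exp (θ * I) * I) := by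
      have : Continuous fun θ : ℝ => P (r, θ) := hPc.comp (by fun_prop)
      exact ((hDc.comp this).clm_apply (by fun_prop)).const_smul r
    have hftc := intervalIntegral.integral_eq_sub_of_hasDerivAt (fun θ _ => hd θ)
      (hcont.intervalIntegrable (-Real.pi) Real.pi)
    -- The angular derivative integrates to zero over a full circle by periodicity.
    have hper : P (r, Real.pi) = P (r, -Real.pi) := by
      simp [P, exp_neg, exp_pi_mul_I]
    rw [hper, sub_self, intervalIntegral.integral_of_le (by linarith [Real.pi_pos]),
      integral_Ioc_eq_integral_Ioo, integral_smul] at hftc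
    exact (smul_eq_zero.1 hftc).resolve_left hr.ne'
  calc ∫ η, dbarDir (D η) 1 * cauchyKernel ζ η
      = ∫ x, dbarDir (D (ζ + x)) 1 * cauchyKernel ζ (ζ + x) :=
        (integral_add_left_eq_self (fun η => dbarDir (D η) 1 * cauchyKernel ζ η) ζ).symm
    -- In polar coordinates about ζ the kernel is -1/(r e^{iθ}): the Jacobian cancels r, the polar
    -- form of ∂̄ cancels e^{iθ}, and no singularity remains.
    _ = ∫ q in S, (-(1 / 2) : ℂ) *
          (D (P q) (exp (q.2 * I)) + I * D (P q) (exp (q.2 * I) * I)) := by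
        rw [← Complex.integral_comp_polarCoord_symm]
        refine setIntegral_congr_fun hSm fun q hq => ?_
        have hq0 : (q.1 : ℂ) ≠ 0 := ofReal_ne_zero.2 (ne_of_gt hq.1)
        have hpol : (Complex.polarCoord.symm q : ℂ) = q.1 * exp (q.2 * I) := by
          rw [Complex.polarCoord_symm_apply, exp_mul_I, ofReal_cos, ofReal_sin]
        simp only [hpol, cauchyKernel, sub_add_cancel_left]
        rw [dbarDir_one_mul_exp _ q.2, real_smul]
        have := exp_ne_zero (q.2 * I)
        field_simp
        rfl
    _ = Real.pi * φ ζ := by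
        rw [integral_const_mul, integral_add hA (hB.const_mul I), integral_const_mul, hradial,
          hangular]
        ring

/-! ### The product domain, test functions and their slices. -/

theorem puncDisc_eq : puncDisc = disc \ {0} := by
  ext z
  simp [puncDisc, disc, and_comm]

theorem isOpen_puncDisc : IsOpen puncDisc := by
  rw [puncDisc_eq]
  exact isOpen_disc.sdiff isClosed_singleton

theorem puncDisc_subset_disc : puncDisc ⊆ disc := fun _ hz => hz.2

/-- The origin is a null set, so both variables can carry the same measure; the puncture matters
only for supports of test functions. -/
theorem restrict_puncDisc :
    (volume.restrict puncDisc : Measure ℂ) = volume.restrict disc := by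
  rw [puncDisc_eq]
  exact Measure.restrict_congr_set (sdiff_null_ae_eq_self (measure_singleton 0))

theorem isOpen_disc_prod_puncDisc : IsOpen (disc ×ˢ puncDisc) := isOpen_disc.prod isOpen_puncDisc

theorem restrict_disc_prod_puncDisc :
    (volume.restrict (disc ×ˢ puncDisc) : Measure (ℂ × ℂ)) =
      (volume.restrict disc).prod (volume.restrict disc) := by
  rw [Measure.volume_eq_prod, ← Measure.prod_restrict, restrict_puncDisc]

theorem isTestFunction_of_isCompact {Ω K : Set (ℂ × ℂ)} {ψ : ℂ × ℂ → ℂ} (hψ : ContDiff ℝ ∞ ψ)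
    (hK : IsCompact K) (hKΩ : K ⊆ Ω) (h : ∀ z, z ∉ K → ψ z = 0) : IsTestFunction Ω ψ := by
  have hs : tsupport ψ ⊆ K := closure_minimal
    (fun z hz => by_contra fun hzK => hz (h z hzK)) hK.isClosed
  exact ⟨hψ, HasCompactSupport.intro hK h, hs.trans hKΩ⟩

section Slices

variable {Ω : Set (ℂ × ℂ)} {ψ : ℂ × ℂ → ℂ}

theorem dbar_eq_dbarDir (j : Fin 2) (ψ : ℂ × ℂ → ℂ) (z : ℂ × ℂ) :
    dbar j ψ z = dbarDir (fderiv ℝ ψ z) (coordVec j) := rfl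

theorem dbar_zero_eq_slice {a b : ℂ} (h : DifferentiableAt ℝ ψ (a, b)) :
    dbar 0 ψ (a, b) = dbarDir (fderiv ℝ (fun x => ψ (x, b)) a) 1 := by
  have : HasFDerivAt (fun x => ψ (x, b)) _ a :=
    HasFDerivAt.comp (g := ψ) a h.hasFDerivAt (hasFDerivAt_prodMk_left a b)
  rw [this.fderiv, dbar_eq_dbarDir]
  simp [dbarDir, coordVec]

theorem dbar_one_eq_slice {a b : ℂ} (h : DifferentiableAt ℝ ψ (a, b)) :
    dbar 1 ψ (a, b) = dbarDir (fderiv ℝ (fun x => ψ (a, x)) b) 1 := by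
  have : HasFDerivAt (fun x => ψ (a, x)) _ b :=
    HasFDerivAt.comp (g := ψ) b h.hasFDerivAt (hasFDerivAt_prodMk_right a b)
  rw [this.fderiv, dbar_eq_dbarDir]
  simp [dbarDir, coordVec]

theorem continuous_dbar (hψ : ContDiff ℝ ∞ ψ) (j : Fin 2) : Continuous (dbar j ψ) := by
  have hD : Continuous (fderiv ℝ ψ) := hψ.continuous_fderiv (by simp)
  exact continuous_const.mul ((hD.clm_apply continuous_const).add
    (continuous_const.mul (hD.clm_apply continuous_const)))

theorem dbar_eq_zero_of_notMem {z : ℂ × ℂ} (hz : z ∉ tsupport ψ) (j : Fin 2) : dbar j ψ z = 0 := by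
  have : fderiv ℝ ψ z = 0 :=
    image_eq_zero_of_notMem_tsupport fun h => hz (tsupport_fderiv_subset ℝ h)
  simp [dbar, this]

theorem IsTestFunction.differentiableAt (hψ : IsTestFunction Ω ψ) (z : ℂ × ℂ) :
    DifferentiableAt ℝ ψ z := hψ.1.differentiable (by simp) z

theorem IsTestFunction.dbar_bound (hψ : IsTestFunction Ω ψ) (j : Fin 2) :
    ∃ c, ∀ z, ‖dbar j ψ z‖ ≤ c :=
  (HasCompactSupport.intro (f := dbar j ψ) hψ.2.1.isCompact
    fun _ hz => dbar_eq_zero_of_notMem hz j).exists_bound_of_continuous (continuous_dbar hψ.1 j)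

theorem IsTestFunction.bound (hψ : IsTestFunction Ω ψ) : ∃ c, ∀ z, ‖ψ z‖ ≤ c :=
  hψ.2.1.exists_bound_of_continuous hψ.1.continuous

theorem IsTestFunction.dbar_eq_zero (hψ : IsTestFunction Ω ψ) {z : ℂ × ℂ} (hz : z ∉ Ω)
    (j : Fin 2) : dbar j ψ z = 0 :=
  dbar_eq_zero_of_notMem (fun h => hz (hψ.2.2 h)) j

theorem IsTestFunction.slice_fst (hψ : IsTestFunction Ω ψ) (b : ℂ) :
    ContDiff ℝ ∞ (fun x => ψ (x, b)) ∧ HasCompactSupport fun x => ψ (x, b) := by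
  refine ⟨hψ.1.comp (contDiff_id.prodMk contDiff_const), ?_⟩
  refine HasCompactSupport.intro (hψ.2.1.isCompact.image continuous_fst) fun x hx => ?_
  exact image_eq_zero_of_notMem_tsupport fun h => hx ⟨_, h, rfl⟩

theorem IsTestFunction.slice_snd (hψ : IsTestFunction Ω ψ) (a : ℂ) :
    ContDiff ℝ ∞ (fun x => ψ (a, x)) ∧ HasCompactSupport fun x => ψ (a, x) := by
  refine ⟨hψ.1.comp (contDiff_const.prodMk contDiff_id), ?_⟩
  refine HasCompactSupport.intro (hψ.2.1.isCompact.image continuous_snd) fun x hx => ?_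
  exact image_eq_zero_of_notMem_tsupport fun h => hx ⟨_, h, rfl⟩

end Slices

/-! ### The solution operator on 𝔻 × 𝔻*. -/

section Product

variable {ψ : ℂ × ℂ → ℂ}

theorem IsTestFunction.integral_dbar_one_mul_cauchyKernel
    (hψ : IsTestFunction (disc ×ˢ puncDisc) ψ) (a ζ : ℂ) :
    ∫ η in disc, dbar 1 ψ (a, η) * cauchyKernel ζ η = Real.pi * ψ (a, ζ) := by
  rw [setIntegral_eq_integral_of_forall_compl_eq_zero fun η hη => by
    rw [hψ.dbar_eq_zero (fun h => hη (puncDisc_subset_disc h.2)), zero_mul]]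
  simp only [dbar_one_eq_slice (hψ.differentiableAt _)]
  exact integral_dbarDir_mul_cauchyKernel ((hψ.slice_snd a).1.of_le (by simp)) (hψ.slice_snd a).2 ζ

theorem IsTestFunction.integral_dbar_zero_mul_cauchyKernel
    (hψ : IsTestFunction (disc ×ˢ puncDisc) ψ) (a ζ : ℂ) :
    ∫ η in disc, dbar 0 ψ (η, a) * cauchyKernel ζ η = Real.pi * ψ (ζ, a) := by
  rw [setIntegral_eq_integral_of_forall_compl_eq_zero fun η hη => by
    rw [hψ.dbar_eq_zero (fun h => hη h.1), zero_mul]]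
  simp only [dbar_zero_eq_slice (hψ.differentiableAt _)]
  exact integral_dbarDir_mul_cauchyKernel ((hψ.slice_fst a).1.of_le (by simp)) (hψ.slice_fst a).2 ζ

/-- An identity of integrals against all products `θ(z₁) χ(z₂)` localizes in the second variable. -/
theorem ae_integral_slice_eq_zero {H : ℂ × ℂ → ℂ}
    (hH : Integrable H ((volume.restrict disc).prod (volume.restrict disc)))
    (h : ∀ χ : ℂ → ℝ, ContDiff ℝ ∞ χ → HasCompactSupport χ → tsupport χ ⊆ puncDisc →
      ∫ z, χ z.2 • H z ∂((volume.restrict disc).prod (volume.restrict disc)) = 0) :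
    ∀ᵐ ζ ∂(volume.restrict disc), ∫ a in disc, H (a, ζ) = 0 := by
  have hint : IntegrableOn (fun ζ => ∫ a in disc, H (a, ζ)) puncDisc := by
    rw [IntegrableOn, restrict_puncDisc]
    exact hH.integral_prod_right
  -- The fundamental lemma of the calculus of variations on 𝔻*, applied to the slice integral as a
  -- function of ζ.
  have key := isOpen_puncDisc.ae_eq_zero_of_integral_contDiff_smul_eq_zero
    hint.locallyIntegrableOn (fun χ hχ hχc hχs => ?_)
  · rw [← restrict_puncDisc, ae_restrict_iff' isOpen_puncDisc.measurableSet]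
    simp only [restrict_puncDisc]
    exact key
  · rw [← h χ hχ hχc hχs]
    obtain ⟨c, hc⟩ := hχc.exists_bound_of_continuous hχ.continuous
    rw [integral_prod_symm]
    · simp only [integral_smul]
      refine (setIntegral_eq_integral_of_forall_compl_eq_zero fun ζ hζ => ?_).symm
      rw [image_eq_zero_of_notMem_tsupport fun hmem => hζ (puncDisc_subset_disc (hχs hmem)),
        zero_smul]
    · exact hH.bdd_smul c (hχ.continuous.comp continuous_snd).aestronglyMeasurable
        (.of_forall fun z => hc _)

theorem isTestFunction_mul_slices {θ χ : ℂ → ℂ} (hθ : ContDiff ℝ ∞ θ) (hχ : ContDiff ℝ ∞ χ)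
    {K L : Set ℂ} (hK : IsCompact K) (hKd : K ⊆ disc) (hL : IsCompact L) (hLd : L ⊆ puncDisc)
    (hθK : ∀ x, x ∉ K → θ x = 0) (hχL : ∀ x, x ∉ L → χ x = 0) :
    IsTestFunction (disc ×ˢ puncDisc) fun z => θ z.1 * χ z.2 := by
  refine isTestFunction_of_isCompact ((hθ.comp contDiff_fst).mul (hχ.comp contDiff_snd))
    (hK.prod hL) (Set.prod_mono hKd hLd) fun z hz => ?_
  by_cases h1 : z.1 ∈ K
  · rw [hχL _ fun h2 => hz ⟨h1, h2⟩, mul_zero]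
  · rw [hθK _ h1, zero_mul]

theorem dbarDir_fderiv_mul_const {θ : ℂ → ℂ} {x : ℂ} (hθ : DifferentiableAt ℝ θ x) (c : ℂ) :
    dbarDir (fderiv ℝ (fun y => θ y * c) x) 1 = dbarDir (fderiv ℝ θ x) 1 * c := by
  rw [fderiv_mul_const hθ]
  simp only [dbarDir, smul_apply, smul_eq_mul]
  ring

/-- A weak `∂̄₁`-derivative on `𝔻 × 𝔻*` is a weak derivative on almost every slice. -/
theorem ae_slice_weak_dbar_zero {F G : ℂ × ℂ → ℂ}
    (hF : Integrable F ((volume.restrict disc).prod (volume.restrict disc)))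
    (hG : Integrable G ((volume.restrict disc).prod (volume.restrict disc)))
    (hFG : ∀ φ, IsTestFunction (disc ×ˢ puncDisc) φ →
      ∫ z in disc ×ˢ puncDisc, F z * dbar 0 φ z = -∫ z in disc ×ˢ puncDisc, G z * φ z)
    (hψ : IsTestFunction (disc ×ˢ puncDisc) ψ) (b : ℂ) :
    ∀ᵐ ζ ∂(volume.restrict disc),
      ∫ a in disc, F (a, ζ) * dbar 0 ψ (a, b) = -∫ a in disc, G (a, ζ) * ψ (a, b) := by
  obtain ⟨c, hc⟩ := hψ.bound
  obtain ⟨c', hc'⟩ := hψ.dbar_bound 0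
  have hF' : Integrable (fun z : ℂ × ℂ => F z * dbar 0 ψ (z.1, b))
      ((volume.restrict disc).prod (volume.restrict disc)) :=
    hF.mul_bdd (c := c') ((continuous_dbar hψ.1 0).comp (by fun_prop)).aestronglyMeasurable
      (.of_forall fun z => hc' _)
  have hG' : Integrable (fun z : ℂ × ℂ => G z * ψ (z.1, b))
      ((volume.restrict disc).prod (volume.restrict disc)) :=
    hG.mul_bdd (c := c) (hψ.1.continuous.comp (by fun_prop)).aestronglyMeasurable
      (.of_forall fun z => hc _)
  -- With b frozen, ψ(z₁, b) χ(z₂) is an admissible test function, and ∂̄₁ acts on its first factor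
  -- only. The transform of ψ in the second variable could not be used instead, as it need not have
  -- compact support there.
  have key := ae_integral_slice_eq_zero (hF'.add hG') fun χ hχ hχc hχs => by
    obtain ⟨d, hd⟩ := hχc.exists_bound_of_continuous hχ.continuous
    have hχm : AEStronglyMeasurable (fun z : ℂ × ℂ => χ z.2)
        ((volume.restrict disc).prod (volume.restrict disc)) :=
      (hχ.continuous.comp continuous_snd).aestronglyMeasurable
    have hχ' : ContDiff ℝ ∞ fun x => (χ x : ℂ) := ofRealCLM.contDiff.comp hχ
    have htest : IsTestFunction (disc ×ˢ puncDisc) fun z => ψ (z.1, b) * (χ z.2 : ℂ) :=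
      isTestFunction_mul_slices (hψ.slice_fst b).1 hχ' (hψ.2.1.isCompact.image continuous_fst)
        (by rintro _ ⟨z, hz, rfl⟩; exact (hψ.2.2 hz).1) hχc.isCompact hχs
        (fun x hx => image_eq_zero_of_notMem_tsupport fun h => hx ⟨_, h, rfl⟩)
        (fun x hx => by rw [image_eq_zero_of_notMem_tsupport hx, ofReal_zero])
    have h := hFG _ htest
    have hd0 : ∀ z : ℂ × ℂ, dbar 0 (fun z => ψ (z.1, b) * (χ z.2 : ℂ)) z =
        dbar 0 ψ (z.1, b) * χ z.2 := by
      intro z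
      rw [← Prod.mk.eta (p := z), dbar_zero_eq_slice (htest.differentiableAt _),
        dbar_zero_eq_slice (hψ.differentiableAt _)]
      exact dbarDir_fderiv_mul_const (θ := fun x => ψ (x, b)) (x := z.1)
        ((hψ.slice_fst b).1.differentiable (by simp) _) (χ z.2 : ℂ)
    simp only [hd0] at h
    rw [restrict_disc_prod_puncDisc] at h
    simp only [Pi.add_apply, smul_add]
    refine (integral_add (hF'.bdd_smul d hχm (.of_forall fun z => hd _))
      (hG'.bdd_smul d hχm (.of_forall fun z => hd _))).trans ?_
    rw [← eq_neg_iff_add_eq_zero]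
    refine (integral_congr_ae (.of_forall fun z => ?_)).trans (h.trans
      (congrArg Neg.neg (integral_congr_ae (.of_forall fun z => ?_))))
    · simp only [Pi.smul_apply', real_smul]
      ring
    · simp only [Pi.smul_apply', real_smul]
      ring
  filter_upwards [key, hF'.prod_left_ae, hG'.prod_left_ae] with ζ h1 h2 h3
  simp only [Pi.add_apply] at h1
  rwa [integral_add h2 h3, ← eq_neg_iff_add_eq_zero] at h1

/-- A weak `∂̄₂`-derivative on `𝔻 × 𝔻*` is a weak derivative on almost every slice. -/
theorem ae_slice_weak_dbar_one {F G : ℂ × ℂ → ℂ}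
    (hF : Integrable F ((volume.restrict disc).prod (volume.restrict disc)))
    (hG : Integrable G ((volume.restrict disc).prod (volume.restrict disc)))
    (hFG : ∀ φ, IsTestFunction (disc ×ˢ puncDisc) φ →
      ∫ z in disc ×ˢ puncDisc, F z * dbar 1 φ z = -∫ z in disc ×ˢ puncDisc, G z * φ z)
    (hψ : IsTestFunction (disc ×ˢ puncDisc) ψ) (b : ℂ) :
    ∀ᵐ ζ ∂(volume.restrict disc),
      ∫ a in disc, F (ζ, a) * dbar 1 ψ (b, a) = -∫ a in disc, G (ζ, a) * ψ (b, a) := by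
  obtain ⟨c, hc⟩ := hψ.bound
  obtain ⟨c', hc'⟩ := hψ.dbar_bound 1
  have hF' : Integrable (fun z : ℂ × ℂ => F z.swap * dbar 1 ψ (b, z.1))
      ((volume.restrict disc).prod (volume.restrict disc)) :=
    hF.swap.mul_bdd (c := c') ((continuous_dbar hψ.1 1).comp (by fun_prop)).aestronglyMeasurable
      (.of_forall fun z => hc' _)
  have hG' : Integrable (fun z : ℂ × ℂ => G z.swap * ψ (b, z.1))
      ((volume.restrict disc).prod (volume.restrict disc)) :=
    hG.swap.mul_bdd (c := c) (hψ.1.continuous.comp (by fun_prop)).aestronglyMeasurable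
      (.of_forall fun z => hc _)
  have key := ae_integral_slice_eq_zero (hF'.add hG') fun χ hχ hχc hχs => by
    obtain ⟨d, hd⟩ := hχc.exists_bound_of_continuous hχ.continuous
    have hχm : AEStronglyMeasurable (fun z : ℂ × ℂ => χ z.2)
        ((volume.restrict disc).prod (volume.restrict disc)) :=
      (hχ.continuous.comp continuous_snd).aestronglyMeasurable
    have hχ' : ContDiff ℝ ∞ fun x => (χ x : ℂ) := ofRealCLM.contDiff.comp hχ
    have htest : IsTestFunction (disc ×ˢ puncDisc) fun z => (χ z.1 : ℂ) * ψ (b, z.2) :=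
      isTestFunction_mul_slices hχ' (hψ.slice_snd b).1 hχc.isCompact
        (hχs.trans puncDisc_subset_disc) (hψ.2.1.isCompact.image continuous_snd)
        (by rintro _ ⟨z, hz, rfl⟩; exact (hψ.2.2 hz).2)
        (fun x hx => by rw [image_eq_zero_of_notMem_tsupport hx, ofReal_zero])
        (fun x hx => image_eq_zero_of_notMem_tsupport fun h => hx ⟨_, h, rfl⟩)
    have h := hFG _ htest
    have hd0 : ∀ z : ℂ × ℂ, dbar 1 (fun z => (χ z.1 : ℂ) * ψ (b, z.2)) z =
        dbar 1 ψ (b, z.2) * χ z.1 := by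
      intro z
      rw [← Prod.mk.eta (p := z), dbar_one_eq_slice (htest.differentiableAt _),
        dbar_one_eq_slice (hψ.differentiableAt _)]
      simp only [mul_comm (χ z.1 : ℂ)]
      exact dbarDir_fderiv_mul_const (θ := fun x => ψ (b, x)) (x := z.2)
        ((hψ.slice_snd b).1.differentiable (by simp) _) (χ z.1 : ℂ)
    simp only [hd0] at h
    rw [restrict_disc_prod_puncDisc, ← integral_prod_swap,
      ← integral_prod_swap (f := fun z => G z * _)] at h
    simp only [Pi.add_apply, smul_add]
    refine (integral_add (hF'.bdd_smul d hχm (.of_forall fun z => hd _))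
      (hG'.bdd_smul d hχm (.of_forall fun z => hd _))).trans ?_
    rw [← eq_neg_iff_add_eq_zero]
    refine (integral_congr_ae (.of_forall fun z => ?_)).trans (h.trans
      (congrArg Neg.neg (integral_congr_ae (.of_forall fun z => ?_))))
    · simp only [Pi.smul_apply', real_smul, Prod.fst_swap, Prod.snd_swap]
      ring
    · simp only [Pi.smul_apply', real_smul, Prod.fst_swap, Prod.snd_swap]
      ring
  filter_upwards [key, hF'.prod_left_ae, hG'.prod_left_ae] with ζ h1 h2 h3
  simp only [Pi.add_apply] at h1
  rwa [integral_add h2 h3, ← eq_neg_iff_add_eq_zero] at h1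

/-- The solution operator on `𝔻 × 𝔻*` as a combination of one-variable Cauchy transforms. -/
noncomputable def solOp (f : Form01) (g : ℂ × ℂ → ℂ) (w : ℂ × ℂ) : ℂ :=
  -(1 / Real.pi) * sndOp (volume.restrict disc) cauchyKernel (f 1) w
  - (1 / Real.pi) * fstOp (volume.restrict disc) cauchyKernel (f 0) w
  - (1 / Real.pi) ^ 2 * fstOp (volume.restrict disc) cauchyKernel
      (sndOp (volume.restrict disc) cauchyKernel g) w

variable {f : Form01} {g : ℂ × ℂ → ℂ}

theorem integrable_solOp
    (hf : ∀ j, Integrable (f j) ((volume.restrict disc).prod (volume.restrict disc)))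
    (hg : Integrable g ((volume.restrict disc).prod (volume.restrict disc))) :
    Integrable (solOp f g) ((volume.restrict disc).prod (volume.restrict disc)) := by
  obtain ⟨A, hK⟩ := exists_schurKernel_cauchyKernel
  exact (((hK.integrable_sndOp (hf 1)).const_mul _).sub
    ((hK.integrable_fstOp (hf 0)).const_mul _)).sub
    ((hK.integrable_fstOp (hK.integrable_sndOp hg)).const_mul _)

theorem integral_solOp_mul
    (hf : ∀ j, Integrable (f j) ((volume.restrict disc).prod (volume.restrict disc)))
    (hg : Integrable g ((volume.restrict disc).prod (volume.restrict disc)))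
    {ψ : ℂ × ℂ → ℂ} (hψ : Measurable ψ) {c : ℝ} (hc : ∀ w, ‖ψ w‖ ≤ c) :
    ∫ w, solOp f g w * ψ w ∂((volume.restrict disc).prod (volume.restrict disc)) =
      -(1 / Real.pi) * ∫ w, sndOp (volume.restrict disc) cauchyKernel (f 1) w * ψ w
        ∂((volume.restrict disc).prod (volume.restrict disc))
      - (1 / Real.pi) * ∫ w, fstOp (volume.restrict disc) cauchyKernel (f 0) w * ψ w
        ∂((volume.restrict disc).prod (volume.restrict disc))
      - (1 / Real.pi) ^ 2 * ∫ w, fstOp (volume.restrict disc) cauchyKernel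
          (sndOp (volume.restrict disc) cauchyKernel g) w * ψ w
        ∂((volume.restrict disc).prod (volume.restrict disc)) := by
  obtain ⟨A, hK⟩ := exists_schurKernel_cauchyKernel
  have h1 := ((hK.integrable_sndOp (hf 1)).mul_bdd (c := c) hψ.aestronglyMeasurable
    (.of_forall hc)).const_mul (-(1 / Real.pi : ℂ))
  have h2 := ((hK.integrable_fstOp (hf 0)).mul_bdd (c := c) hψ.aestronglyMeasurable
    (.of_forall hc)).const_mul (1 / Real.pi : ℂ)
  have h3 := ((hK.integrable_fstOp (hK.integrable_sndOp hg)).mul_bdd (c := c)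
    hψ.aestronglyMeasurable (.of_forall hc)).const_mul ((1 / Real.pi : ℂ) ^ 2)
  have e12 := integral_sub h1 h2
  have e123 := integral_sub (h1.sub h2) h3
  simp only [Pi.sub_apply] at e123
  rw [← integral_const_mul, ← integral_const_mul, ← integral_const_mul, ← e12, ← e123]
  exact integral_congr_ae (.of_forall fun w => by simp only [solOp]; ring)

/-- For each j, the transform in the other variable, paired with ∂̄ⱼψ, cancels against the double
transform, and the transform in the variable j itself leaves the pairing of fⱼ with ψ. -/
theorem isWeakSolution_solOp
    (hf : ∀ j, Integrable (f j) ((volume.restrict disc).prod (volume.restrict disc)))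
    (hg : Integrable g ((volume.restrict disc).prod (volume.restrict disc)))
    (h0 : ∀ φ, IsTestFunction (disc ×ˢ puncDisc) φ →
      ∫ z in disc ×ˢ puncDisc, f 0 z * dbar 1 φ z = -∫ z in disc ×ˢ puncDisc, g z * φ z)
    (h1 : ∀ φ, IsTestFunction (disc ×ˢ puncDisc) φ →
      ∫ z in disc ×ˢ puncDisc, f 1 z * dbar 0 φ z = -∫ z in disc ×ˢ puncDisc, g z * φ z)
    (hψ : IsTestFunction (disc ×ˢ puncDisc) ψ) (j : Fin 2) :
    ∫ w in disc ×ˢ puncDisc, solOp f g w * dbar j ψ w =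
      -∫ w in disc ×ˢ puncDisc, f j w * ψ w := by
  obtain ⟨A, hK⟩ := exists_schurKernel_cauchyKernel
  obtain ⟨c, hc⟩ := hψ.bound
  obtain ⟨c', hc'⟩ := hψ.dbar_bound j
  have hm := hψ.1.continuous.measurable
  have hm' := (continuous_dbar hψ.1 j).measurable
  have hpi : (Real.pi : ℂ) ≠ 0 := ofReal_ne_zero.2 Real.pi_ne_zero
  rw [restrict_disc_prod_puncDisc, integral_solOp_mul hf hg hm' hc']
  fin_cases j
  · have e1 := hK.integral_sndOp_mul_congr (hf 1) hg hm hc hm' hc'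
      (ae_slice_weak_dbar_zero (hf 1) hg h1 hψ)
    have e2 := hK.integral_fstOp_mul_of_inverse (hf 0) hm' hc'
      hψ.integral_dbar_zero_mul_cauchyKernel
    have e3 := hK.integral_fstOp_mul_of_inverse (hK.integrable_sndOp hg) hm' hc'
      hψ.integral_dbar_zero_mul_cauchyKernel
    simp only [Fin.zero_eta] at e1 e2 e3 ⊢
    rw [e1, e2, e3]
    field_simp
    ring
  · have e1 := hK.integral_fstOp_mul_congr (hf 0) hg hm hc hm' hc'
      (ae_slice_weak_dbar_one (hf 0) hg h0 hψ)
    have e2 := hK.integral_sndOp_mul_of_inverse (hf 1) hm' hc'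
      hψ.integral_dbar_one_mul_cauchyKernel
    have e3 := hK.integral_sndOp_mul_of_inverse (hK.integrable_fstOp hg) hm' hc'
      hψ.integral_dbar_one_mul_cauchyKernel
    -- For the second variable, C₂ must be the outer operator; Fubini permits the exchange wherever
    -- the double integral converges absolutely.
    have e4 : ∫ w, fstOp (volume.restrict disc) cauchyKernel
          (sndOp (volume.restrict disc) cauchyKernel g) w * dbar 1 ψ w
        ∂((volume.restrict disc).prod (volume.restrict disc)) =
        ∫ w, sndOp (volume.restrict disc) cauchyKernel
          (fstOp (volume.restrict disc) cauchyKernel g) w * dbar 1 ψ w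
        ∂((volume.restrict disc).prod (volume.restrict disc)) := by
      refine integral_congr_ae ?_
      filter_upwards [hK.ae_integrable_prod hg] with w hw
      rw [← integral_prod_eq_fstOp_sndOp hw, integral_prod_eq_sndOp_fstOp hw]
    simp only [Fin.mk_one] at e1 e2 e3 ⊢
    rw [e4, e1, e2, e3]
    field_simp
    ring

theorem ae_TConverges
    (hf : ∀ j, Integrable (f j) ((volume.restrict disc).prod (volume.restrict disc)))
    (hg : Integrable (scriptD (disc ×ˢ puncDisc) f)
      ((volume.restrict disc).prod (volume.restrict disc))) :
    ∀ᵐ w ∂((volume.restrict disc).prod (volume.restrict disc)), TConverges f w := by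
  obtain ⟨A, hK⟩ := exists_schurKernel_cauchyKernel
  filter_upwards [hK.ae_integrable_snd (hf 1), hK.ae_integrable_fst (hf 0),
    hK.ae_integrable_prod hg] with w h1 h2 h3
  refine ⟨?_, ?_, ?_⟩
  · rw [IntegrableOn, restrict_puncDisc]
    simpa only [cauchyKernel, div_eq_mul_inv] using h1
  · simpa only [IntegrableOn, cauchyKernel, div_eq_mul_inv] using h2
  · rw [IntegrableOn, restrict_disc_prod_puncDisc]
    simpa only [cauchyKernel, div_eq_mul_inv, mul_inv] using h3

/-- The equality is almost everywhere because the double integral is iterated by Fubini only at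
points of absolute convergence. The factors 2i cancel, leaving -1/π and -1/π². -/
theorem T_ae_eq_solOp
    (hg : Integrable g ((volume.restrict disc).prod (volume.restrict disc)))
    (hfg : scriptD (disc ×ˢ puncDisc) f
      =ᵐ[(volume.restrict disc).prod (volume.restrict disc)] g) :
    T f =ᵐ[(volume.restrict disc).prod (volume.restrict disc)] solOp f g := by
  obtain ⟨A, hK⟩ := exists_schurKernel_cauchyKernel
  filter_upwards [hK.ae_integrable_prod hg] with w hw
  have e : ∫ ζ, scriptD (disc ×ˢ puncDisc) f ζ / ((ζ.1 - w.1) * (ζ.2 - w.2))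
      ∂((volume.restrict disc).prod (volume.restrict disc)) =
      fstOp (volume.restrict disc) cauchyKernel (sndOp (volume.restrict disc) cauchyKernel g) w := by
    rw [← integral_prod_eq_fstOp_sndOp hw]
    refine integral_congr_ae ?_
    filter_upwards [hfg] with ζ hζ
    rw [hζ, cauchyKernel, cauchyKernel, div_eq_mul_inv, mul_inv]
  have hpi : (Real.pi : ℂ) ≠ 0 := ofReal_ne_zero.2 Real.pi_ne_zero
  rw [T, restrict_puncDisc, restrict_disc_prod_puncDisc]
  simp only [integral_mul_const]
  rw [e, solOp]
  simp only [sndOp, cauchyKernel, ← div_eq_mul_inv]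
  simp only [fstOp, cauchyKernel, ← div_eq_mul_inv]
  have hI := I_ne_zero
  field_simp
  ring

theorem eLpNorm_solOp_le {A : ℝ≥0} (hK : SchurKernel (volume.restrict disc) cauchyKernel A)
    (hf : ∀ j, Integrable (f j) ((volume.restrict disc).prod (volume.restrict disc)))
    (hg : Integrable g ((volume.restrict disc).prod (volume.restrict disc)))
    {p : ℝ≥0∞} (hp : 1 ≤ p) (hp' : p ≠ ⊤) :
    eLpNorm (solOp f g) p ((volume.restrict disc).prod (volume.restrict disc)) ≤
      A * eLpNorm (f 1) p ((volume.restrict disc).prod (volume.restrict disc)) +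
      A * eLpNorm (f 0) p ((volume.restrict disc).prod (volume.restrict disc)) +
      A * (A * eLpNorm g p ((volume.restrict disc).prod (volume.restrict disc))) := by
  have hc : ∀ (c : ℂ) (F : ℂ × ℂ → ℂ), ‖c‖ ≤ 1 →
      eLpNorm (fun w => c * F w) p ((volume.restrict disc).prod (volume.restrict disc)) ≤
        eLpNorm F p ((volume.restrict disc).prod (volume.restrict disc)) := by
    intro c F hc
    refine eLpNorm_mono fun w => ?_
    rw [norm_mul]
    exact mul_le_of_le_one_left (norm_nonneg _) hc
  have hpi : ‖(1 / Real.pi : ℂ)‖ ≤ 1 := by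
    rw [norm_div, norm_one, norm_real, Real.norm_eq_abs, abs_of_pos Real.pi_pos]
    exact (div_le_one Real.pi_pos).2 (by linarith [Real.pi_gt_three])
  have i1 := (hK.integrable_sndOp (hf 1)).const_mul (-(1 / Real.pi : ℂ))
  have i2 := (hK.integrable_fstOp (hf 0)).const_mul (1 / Real.pi : ℂ)
  have i3 := (hK.integrable_fstOp (hK.integrable_sndOp hg)).const_mul ((1 / Real.pi : ℂ) ^ 2)
  refine (eLpNorm_sub_le (i1.sub i2).1 i3.1 hp).trans (add_le_add
    ((eLpNorm_sub_le i1.1 i2.1 hp).trans (add_le_add ?_ ?_)) ?_)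
  · exact (hc _ _ (by rwa [norm_neg])).trans (hK.eLpNorm_sndOp_le (hf 1) hp hp')
  · exact (hc _ _ hpi).trans (hK.eLpNorm_fstOp_le (hf 0) hp hp')
  · refine (hc _ _ (by rw [norm_pow]; exact pow_le_one₀ (norm_nonneg _) hpi)).trans
      ((hK.eLpNorm_fstOp_le (hK.integrable_sndOp hg) hp hp').trans ?_)
    gcongr
    exact hK.eLpNorm_sndOp_le hg hp hp'

end Product

/-! ### Chain and product rules for ∂̄ with holomorphic maps. -/

section DbarCalculus

variable {E : Type*} [NormedAddCommGroup E] [NormedSpace ℂ E]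

theorem dbarDir_add (D : E →L[ℝ] ℂ) (v w : E) : dbarDir D (v + w) = dbarDir D v + dbarDir D w := by
  simp only [dbarDir, smul_add, map_add]
  ring

/-- Conjugate linearity in the direction is what makes conjugated Jacobian entries appear in the
chain rule. -/
theorem dbarDir_smul (D : E →L[ℝ] ℂ) (c : ℂ) (v : E) :
    dbarDir D (c • v) = conj c * dbarDir D v := by
  have h : ∀ (a b : ℝ) (v : E), D (((a : ℂ) + b * I) • v) = a * D v + b * D (I • v) := by
    intro a b v
    have : ((a : ℂ) + b * I) • v = a • v + b • (I • v) := by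
      rw [add_smul, mul_smul, coe_smul, coe_smul]
    rw [this, map_add, map_smul, map_smul, real_smul, real_smul]
  have hI : I * (c.re + c.im * I) = ((-c.im : ℝ) : ℂ) + (c.re : ℝ) * I := by
    push_cast
    linear_combination (c.im : ℂ) * I_sq
  obtain ⟨hc, hc'⟩ : c = c.re + c.im * I ∧ conj c = c.re - c.im * I :=
    ⟨(re_add_im c).symm, Complex.ext (by simp) (by simp)⟩
  rw [hc', dbarDir, smul_smul, dbarDir]
  nth_rw 1 2 [hc]
  rw [hI, h, h]
  push_cast
  linear_combination (1 / 2 : ℂ) * (c.im * D (I • v)) * I_sq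

/-- The `∂̄`-derivative of a composition with a holomorphic map. -/
theorem dbarDir_fderiv_comp {F : Type*} [NormedAddCommGroup F] [NormedSpace ℂ F] {ψ : F → ℂ}
    {Φ : E → F} {L : E →L[ℂ] F} {z : E} (hψ : DifferentiableAt ℝ ψ (Φ z))
    (hΦ : HasFDerivAt Φ L z) (v : E) :
    dbarDir (fderiv ℝ (ψ ∘ Φ) z) v = dbarDir (fderiv ℝ ψ (Φ z)) (L v) := by
  rw [(hψ.hasFDerivAt.comp z (hΦ.restrictScalars ℝ)).fderiv]
  simp [dbarDir]

/-- The `∂̄`-derivative of a product with `h̄ k`, where `h` and `k` are holomorphic. -/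
theorem dbarDir_fderiv_conj_mul_mul {ψ h k : E → ℂ} {h' : E →L[ℂ] ℂ} {z : E}
    (hψ : DifferentiableAt ℝ ψ z) (hh : HasFDerivAt h h' z) (hk : DifferentiableAt ℂ k z) (v : E) :
    dbarDir (fderiv ℝ (fun x => conj (h x) * k x * ψ x) z) v =
      conj (h z) * k z * dbarDir (fderiv ℝ ψ z) v + conj (h' v) * k z * ψ z := by
  obtain ⟨k', hk⟩ := hk
  have hc : HasFDerivAt (fun x => conj (h x)) _ z :=
    (conjCLE : ℂ →L[ℝ] ℂ).hasFDerivAt.comp z (hh.restrictScalars ℝ)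
  have hd : HasFDerivAt (fun x => conj (h x) * k x * ψ x) _ z :=
    (hc.mul (hk.restrictScalars ℝ)).mul hψ.hasFDerivAt
  rw [hd.fderiv]
  simp only [dbarDir, add_apply, smul_apply, smul_eq_mul, ContinuousLinearMap.comp_apply,
    Pi.mul_apply, ContinuousLinearMap.coe_restrictScalars', map_smul, ContinuousLinearEquiv.coe_coe,
    conjCLE_apply, map_mul, conj_I]
  linear_combination (1 / 2 * (k' v * conj (h z) - k z * conj (h' v)) * ψ z) * I_sq

end DbarCalculus

/-- The multiplier need be smooth on Ω only, which admits 1/z₂ and z₁/z₂ on the Hartogs triangle. -/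
theorem IsTestFunction.mul {Ω : Set (ℂ × ℂ)} {ψ a : ℂ × ℂ → ℂ} (hψ : IsTestFunction Ω ψ)
    (ha : ∀ z ∈ Ω, ContDiffAt ℝ ∞ a z) : IsTestFunction Ω fun z => a z * ψ z := by
  refine isTestFunction_of_isCompact (contDiff_iff_contDiffAt.2 fun z => ?_) hψ.2.1.isCompact
    hψ.2.2 fun z hz => by rw [image_eq_zero_of_notMem_tsupport hz, mul_zero]
  by_cases hz : z ∈ tsupport ψ
  · exact (ha z (hψ.2.2 hz)).mul hψ.1.contDiffAt
  · refine contDiffAt_const (c := (0 : ℂ)) |>.congr_of_eventuallyEq ?_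
    filter_upwards [(isClosed_tsupport ψ).isOpen_compl.mem_nhds hz] with x hx
    rw [image_eq_zero_of_notMem_tsupport hx, mul_zero]

theorem IsTestFunction.conj_mul_mul {Ω : Set (ℂ × ℂ)} {ψ h k : ℂ × ℂ → ℂ}
    (hψ : IsTestFunction Ω ψ) (hh : ∀ z ∈ Ω, ContDiffAt ℂ ∞ h z)
    (hk : ∀ z ∈ Ω, ContDiffAt ℂ ∞ k z) :
    IsTestFunction Ω fun z => conj (h z) * k z * ψ z :=
  hψ.mul fun z hz => (conjCLE.contDiff.contDiffAt.comp z ((hh z hz).restrict_scalars ℝ)).mul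
    ((hk z hz).restrict_scalars ℝ)

/-- Transport of test functions along a diffeomorphism of open sets. -/
theorem IsTestFunction.comp {U V : Set (ℂ × ℂ)} {ψ : ℂ × ℂ → ℂ} (hψ : IsTestFunction V ψ)
    {Φ Φinv : ℂ × ℂ → ℂ × ℂ} (h1 : ∀ z, Φ z ∈ V → z ∈ U ∧ Φinv (Φ z) = z)
    (h2 : ∀ w ∈ V, Φinv w ∈ U) (h3 : ContinuousOn Φinv V) (h4 : ∀ z ∈ U, ContDiffAt ℂ ∞ Φ z) :
    IsTestFunction U (ψ ∘ Φ) := by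
  have hK : IsCompact (Φinv '' tsupport ψ) := hψ.2.1.isCompact.image_of_continuousOn (h3.mono hψ.2.2)
  have hKU : Φinv '' tsupport ψ ⊆ U := by
    rintro _ ⟨w, hw, rfl⟩
    exact h2 w (hψ.2.2 hw)
  have h0 : ∀ z, z ∉ Φinv '' tsupport ψ → (ψ ∘ Φ) z = 0 := by
    intro z hz
    refine image_eq_zero_of_notMem_tsupport (f := ψ) fun h => hz ⟨_, h, ?_⟩
    exact (h1 z (hψ.2.2 h)).2
  refine isTestFunction_of_isCompact (contDiff_iff_contDiffAt.2 fun z => ?_) hK hKU h0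
  by_cases hz : z ∈ Φinv '' tsupport ψ
  · exact hψ.1.contDiffAt.comp z ((h4 z (hKU hz)).restrict_scalars ℝ)
  · refine contDiffAt_const (c := (0 : ℂ)) |>.congr_of_eventuallyEq ?_
    filter_upwards [hK.isClosed.isOpen_compl.mem_nhds hz] with x hx
    exact h0 x hx

/-! ### The biholomorphism and its change of variables. -/

section Hartogs

theorem snd_ne_zero_of_mem_hartogs {z : ℂ × ℂ} (hz : z ∈ hartogs) : z.2 ≠ 0 :=
  norm_pos_iff.1 ((norm_nonneg _).trans_lt hz.1)

theorem snd_ne_zero_of_mem_prod {w : ℂ × ℂ} (hw : w ∈ disc ×ˢ puncDisc) : w.2 ≠ 0 :=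
  norm_pos_iff.1 hw.2.1

/-- No condition z₂ ≠ 0 is needed: if z₂ = 0, the image has second coordinate 0 and lies outside 𝔻 ×
𝔻*. -/
theorem phi_mem_iff {z : ℂ × ℂ} : phi z ∈ disc ×ˢ puncDisc ↔ z ∈ hartogs := by
  simp only [phi, disc, puncDisc, hartogs, Set.mem_prod, Set.mem_ofPred_eq, norm_div]
  constructor
  · rintro ⟨h1, h2, h3⟩
    exact ⟨(div_lt_one h2).1 h1, h3⟩
  · rintro ⟨h1, h2⟩
    have := (norm_nonneg _).trans_lt h1
    exact ⟨(div_lt_one this).2 h1, this, h2⟩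

theorem phiInv_phi {z : ℂ × ℂ} (hz : z ∈ hartogs) : phiInv (phi z) = z := by
  simp [phiInv, phi, div_mul_cancel₀ _ (snd_ne_zero_of_mem_hartogs hz)]

theorem phi_phiInv {w : ℂ × ℂ} (hw : w ∈ disc ×ˢ puncDisc) : phi (phiInv w) = w := by
  simp [phiInv, phi, mul_div_cancel_right₀ _ (snd_ne_zero_of_mem_prod hw)]

theorem phiInv_mem {w : ℂ × ℂ} (hw : w ∈ disc ×ˢ puncDisc) : phiInv w ∈ hartogs := by
  rw [← phi_mem_iff, phi_phiInv hw]
  exact hw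

theorem mem_of_phiInv_mem {w : ℂ × ℂ} (hw : phiInv w ∈ hartogs) : w ∈ disc ×ˢ puncDisc := by
  have h0 : w.2 ≠ 0 := snd_ne_zero_of_mem_hartogs (z := phiInv w) hw
  have : phi (phiInv w) = w := by simp [phiInv, phi, mul_div_cancel_right₀ _ h0]
  rw [← this]
  exact phi_mem_iff.2 hw

theorem isOpen_hartogs : IsOpen hartogs :=
  (isOpen_lt continuous_fst.norm continuous_snd.norm).inter
    (isOpen_lt continuous_snd.norm continuous_const)

/-- The derivative of `phiInv`. -/
noncomputable def phiInvDeriv (w : ℂ × ℂ) : ℂ × ℂ →L[ℂ] ℂ × ℂ :=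
  (w.1 • ContinuousLinearMap.snd ℂ ℂ ℂ + w.2 • ContinuousLinearMap.fst ℂ ℂ ℂ).prod
    (ContinuousLinearMap.snd ℂ ℂ ℂ)

theorem hasFDerivAt_phiInv (w : ℂ × ℂ) : HasFDerivAt phiInv (phiInvDeriv w) w :=
  (hasFDerivAt_fst.mul hasFDerivAt_snd).prodMk hasFDerivAt_snd

theorem hasFDerivAt_fst_div_snd {z : ℂ × ℂ} (hz : z.2 ≠ 0) :
    HasFDerivAt (fun z : ℂ × ℂ => z.1 / z.2) (z.2⁻¹ • ContinuousLinearMap.fst ℂ ℂ ℂ -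
      (z.1 / z.2 ^ 2) • ContinuousLinearMap.snd ℂ ℂ ℂ) z := by
  have h : HasFDerivAt (fun z : ℂ × ℂ => z.2⁻¹) _ z :=
    (hasFDerivAt_inv hz).comp z hasFDerivAt_snd
  refine (hasFDerivAt_fst.mul h).congr_fderiv ?_
  ext
  · simp
  · simp
    ring

theorem hasFDerivAt_phi {z : ℂ × ℂ} (hz : z.2 ≠ 0) :
    HasFDerivAt phi ((z.2⁻¹ • ContinuousLinearMap.fst ℂ ℂ ℂ -
      (z.1 / z.2 ^ 2) • ContinuousLinearMap.snd ℂ ℂ ℂ).prod (ContinuousLinearMap.snd ℂ ℂ ℂ)) z :=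
  (hasFDerivAt_fst_div_snd hz).prodMk hasFDerivAt_snd

theorem contDiffAt_inv_snd {z : ℂ × ℂ} (hz : z.2 ≠ 0) :
    ContDiffAt ℂ ∞ (fun z : ℂ × ℂ => z.2⁻¹) z := contDiffAt_snd.inv hz

theorem contDiffAt_fst_div_snd {z : ℂ × ℂ} (hz : z.2 ≠ 0) :
    ContDiffAt ℂ ∞ (fun z : ℂ × ℂ => z.1 / z.2) z := contDiffAt_fst.div contDiffAt_snd hz

theorem IsTestFunction.comp_phi {ψ : ℂ × ℂ → ℂ} (hψ : IsTestFunction (disc ×ˢ puncDisc) ψ) :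
    IsTestFunction hartogs (ψ ∘ phi) :=
  hψ.comp (fun _ hz => ⟨phi_mem_iff.1 hz, phiInv_phi (phi_mem_iff.1 hz)⟩) (fun _ => phiInv_mem)
    (fun w _ => (hasFDerivAt_phiInv w).continuousAt.continuousWithinAt)
    fun _ hz => (contDiffAt_fst_div_snd (snd_ne_zero_of_mem_hartogs hz)).prodMk contDiffAt_snd

theorem IsTestFunction.comp_phiInv {φ : ℂ × ℂ → ℂ} (hφ : IsTestFunction hartogs φ) :
    IsTestFunction (disc ×ˢ puncDisc) (φ ∘ phiInv) :=
  hφ.comp (fun _ hw => ⟨mem_of_phiInv_mem hw, phi_phiInv (mem_of_phiInv_mem hw)⟩)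
    (fun _ => phi_mem_iff.2)
    (fun _ hz => (hasFDerivAt_phi (snd_ne_zero_of_mem_hartogs hz)).continuousAt.continuousWithinAt)
    fun _ _ => (contDiffAt_fst.mul contDiffAt_snd).prodMk contDiffAt_snd

theorem smul_coordVec_zero (c : ℂ) : c • coordVec 0 = (c, 0) := by simp [coordVec]

theorem add_coordVec_one (c : ℂ) : c • coordVec 0 + coordVec 1 = (c, 1) := by simp [coordVec]

theorem dbar_zero_comp_phi {ψ : ℂ × ℂ → ℂ} {z : ℂ × ℂ} (hψ : DifferentiableAt ℝ ψ (phi z))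
    (hz : z.2 ≠ 0) : dbar 0 (ψ ∘ phi) z = conj z.2⁻¹ * dbar 0 ψ (phi z) := by
  rw [dbar_eq_dbarDir, dbarDir_fderiv_comp hψ (hasFDerivAt_phi hz), dbar_eq_dbarDir,
    ← dbarDir_smul, smul_coordVec_zero]
  congr 1
  simp [coordVec]

theorem dbar_one_comp_phi {ψ : ℂ × ℂ → ℂ} {z : ℂ × ℂ} (hψ : DifferentiableAt ℝ ψ (phi z))
    (hz : z.2 ≠ 0) :
    dbar 1 (ψ ∘ phi) z = conj (-(z.1 / z.2 ^ 2)) * dbar 0 ψ (phi z) + dbar 1 ψ (phi z) := by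
  rw [dbar_eq_dbarDir, dbarDir_fderiv_comp hψ (hasFDerivAt_phi hz), dbar_eq_dbarDir,
    dbar_eq_dbarDir, ← dbarDir_smul, ← dbarDir_add, add_coordVec_one]
  congr 1
  simp [coordVec]

theorem dbar_zero_comp_phiInv {φ : ℂ × ℂ → ℂ} {w : ℂ × ℂ}
    (hφ : DifferentiableAt ℝ φ (phiInv w)) :
    dbar 0 (φ ∘ phiInv) w = conj w.2 * dbar 0 φ (phiInv w) := by
  rw [dbar_eq_dbarDir, dbarDir_fderiv_comp hφ (hasFDerivAt_phiInv w), dbar_eq_dbarDir,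
    ← dbarDir_smul, smul_coordVec_zero]
  congr 1
  simp [coordVec, phiInvDeriv]

theorem dbar_one_comp_phiInv {φ : ℂ × ℂ → ℂ} {w : ℂ × ℂ}
    (hφ : DifferentiableAt ℝ φ (phiInv w)) :
    dbar 1 (φ ∘ phiInv) w = conj w.1 * dbar 0 φ (phiInv w) + dbar 1 φ (phiInv w) := by
  rw [dbar_eq_dbarDir, dbarDir_fderiv_comp hφ (hasFDerivAt_phiInv w), dbar_eq_dbarDir,
    dbar_eq_dbarDir, ← dbarDir_smul, ← dbarDir_add, add_coordVec_one]
  congr 1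
  simp [coordVec, phiInvDeriv]

/-- The complex determinant is w₂, and the real determinant of a complex linear map is the squared
modulus of the complex one. -/
theorem det_phiInvDeriv (w : ℂ × ℂ) :
    ((phiInvDeriv w).restrictScalars ℝ).det = ‖w.2‖ ^ 2 := by
  have h : LinearMap.det (phiInvDeriv w : ℂ × ℂ →ₗ[ℂ] ℂ × ℂ) = w.2 := by
    rw [← LinearMap.det_toMatrix (Module.Basis.finTwoProd ℂ), Matrix.det_fin_two]
    simp [LinearMap.toMatrix_apply, phiInvDeriv]
  have h2 := LinearMap.det_restrictScalars (R := ℝ) (S := ℂ)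
    (f := (phiInvDeriv w : ℂ × ℂ →ₗ[ℂ] ℂ × ℂ))
  rw [h, Algebra.norm_complex_apply, normSq_eq_norm_sq] at h2
  exact h2

theorem image_phiInv (s : Set (ℂ × ℂ)) :
    phiInv '' (disc ×ˢ puncDisc ∩ phiInv ⁻¹' s) = hartogs ∩ s := by
  ext z
  constructor
  · rintro ⟨w, ⟨hw, hws⟩, rfl⟩
    exact ⟨phiInv_mem hw, hws⟩
  · rintro ⟨hz, hzs⟩
    exact ⟨phi z, ⟨phi_mem_iff.2 hz, by rwa [Set.mem_preimage, phiInv_phi hz]⟩, phiInv_phi hz⟩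

theorem injOn_phiInv : Set.InjOn phiInv (disc ×ˢ puncDisc) := fun w hw w' hw' h => by
  rw [← phi_phiInv hw, ← phi_phiInv hw', h]

instance isAddHaarMeasure_volume_prod : (volume : Measure (ℂ × ℂ)).IsAddHaarMeasure :=
  inferInstanceAs ((volume : Measure ℂ).prod volume).IsAddHaarMeasure

theorem setIntegral_hartogs (F : ℂ × ℂ → ℂ) :
    ∫ z in hartogs, F z = ∫ w in disc ×ˢ puncDisc, w.2 * conj w.2 * F (phiInv w) := by
  have h := integral_image_eq_integral_abs_det_fderiv_smul (volume : Measure (ℂ × ℂ))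
    isOpen_disc_prod_puncDisc.measurableSet
    (fun w _ => ((hasFDerivAt_phiInv w).restrictScalars ℝ).hasFDerivWithinAt) injOn_phiInv F
  have hi := image_phiInv Set.univ
  rw [Set.preimage_univ, Set.inter_univ, Set.inter_univ] at hi
  rw [hi] at h
  rw [h]
  refine integral_congr_ae (.of_forall fun w => ?_)
  simp only [det_phiInvDeriv]
  rw [abs_of_nonneg (by positivity), real_smul, mul_conj, normSq_eq_norm_sq]

theorem setIntegral_disc_prod_puncDisc (F : ℂ × ℂ → ℂ) :
    ∫ w in disc ×ˢ puncDisc, F w = ∫ z in hartogs, (z.2 * conj z.2)⁻¹ * F (phi z) := by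
  rw [setIntegral_hartogs]
  refine setIntegral_congr_fun isOpen_disc_prod_puncDisc.measurableSet fun w hw => ?_
  have h0 := snd_ne_zero_of_mem_prod hw
  have h1 : conj w.2 ≠ 0 := (map_ne_zero _).2 h0
  simp only [phi_phiInv hw]
  rw [show (phiInv w).2 = w.2 from rfl, mul_inv_cancel_left₀ (mul_ne_zero h0 h1)]

end Hartogs

theorem IsTestFunction.integrableOn_mul {Ω : Set (ℂ × ℂ)} {F φ : ℂ × ℂ → ℂ}
    (hφ : IsTestFunction Ω φ) (hF : IntegrableOn F Ω) : IntegrableOn (fun z => F z * φ z) Ω := by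
  obtain ⟨c, hc⟩ := hφ.bound
  exact hF.mul_bdd (c := c) hφ.1.continuous.aestronglyMeasurable (.of_forall hc)

theorem IsTestFunction.integrableOn_mul_dbar {Ω : Set (ℂ × ℂ)} {F φ : ℂ × ℂ → ℂ}
    (hφ : IsTestFunction Ω φ) (hF : IntegrableOn F Ω) (j : Fin 2) :
    IntegrableOn (fun z => F z * dbar j φ z) Ω := by
  obtain ⟨c, hc⟩ := hφ.dbar_bound j
  exact hF.mul_bdd (c := c) (continuous_dbar hφ.1 j).aestronglyMeasurable (.of_forall hc)

/-- The function representing `𝒟f` for `f = (φ⁻¹)^* α`, in terms of the weak derivatives of `α₁`. -/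
noncomputable def pullbackD (α : Form01) (dα₁ : Fin 2 → ℂ × ℂ → ℂ) (w : ℂ × ℂ) : ℂ :=
  conj w.2 * (conj w.1 * dα₁ 0 (phiInv w) + dα₁ 1 (phiInv w)) + α 0 (phiInv w)

/-! ### Weak derivatives of the pulled-back form, and transport of solutions. -/

section Pullback

variable {α : Form01} {dα₁ : Fin 2 → ℂ × ℂ → ℂ} {ψ : ℂ × ℂ → ℂ}

theorem IsTestFunction.inv_snd_mul (hφ : IsTestFunction hartogs ψ) :
    IsTestFunction hartogs fun z => conj (1 : ℂ) * z.2⁻¹ * ψ z :=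
  hφ.conj_mul_mul (h := fun _ => 1) (fun _ _ => contDiffAt_const)
    fun _ hz => contDiffAt_inv_snd (snd_ne_zero_of_mem_hartogs hz)

theorem IsTestFunction.conj_div_mul (hφ : IsTestFunction hartogs ψ) :
    IsTestFunction hartogs fun z => conj (z.1 / z.2) * z.2⁻¹ * ψ z :=
  hφ.conj_mul_mul (fun _ hz => contDiffAt_fst_div_snd (snd_ne_zero_of_mem_hartogs hz))
    fun _ hz => contDiffAt_inv_snd (snd_ne_zero_of_mem_hartogs hz)

theorem IsTestFunction.conj_inv_mul (hφ : IsTestFunction hartogs ψ) :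
    IsTestFunction hartogs fun z => conj z.2⁻¹ * z.2⁻¹ * ψ z :=
  hφ.conj_mul_mul (fun _ hz => contDiffAt_inv_snd (snd_ne_zero_of_mem_hartogs hz))
    fun _ hz => contDiffAt_inv_snd (snd_ne_zero_of_mem_hartogs hz)

theorem dbar_inv_snd_mul {z : ℂ × ℂ} (hψ : DifferentiableAt ℝ ψ z) (hz : z.2 ≠ 0) (j : Fin 2) :
    dbar j (fun z => conj (1 : ℂ) * z.2⁻¹ * ψ z) z = z.2⁻¹ * dbar j ψ z := by
  rw [dbar_eq_dbarDir, dbarDir_fderiv_conj_mul_mul (h := fun _ => 1) hψ (hasFDerivAt_const 1 z)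
    ((contDiffAt_inv_snd hz).differentiableAt (by simp)), dbar_eq_dbarDir]
  simp

theorem dbar_zero_conj_div_mul {z : ℂ × ℂ} (hψ : DifferentiableAt ℝ ψ z) (hz : z.2 ≠ 0) :
    dbar 0 (fun z => conj (z.1 / z.2) * z.2⁻¹ * ψ z) z =
      conj (z.1 / z.2) * z.2⁻¹ * dbar 0 ψ z + conj z.2⁻¹ * z.2⁻¹ * ψ z := by
  rw [dbar_eq_dbarDir, dbarDir_fderiv_conj_mul_mul hψ (hasFDerivAt_fst_div_snd hz)
    ((contDiffAt_inv_snd hz).differentiableAt (by simp)), dbar_eq_dbarDir]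
  simp [coordVec]

/-- The Jacobian factor 1/(z₂ z̄₂) is absorbed into the test functions. The form of the right side
is chosen so that the last integral cancels the term produced by ∂̄₁ hitting conj(z₁/z₂). -/
theorem integral_pullbackD_mul
    (hα : IntegrableOn (α 0) hartogs) (hdα : ∀ j, IntegrableOn (dα₁ j) hartogs)
    (hweak : ∀ j, HasWeakDbar hartogs j (α 0) (dα₁ j))
    (hψ : IsTestFunction (disc ×ˢ puncDisc) ψ) :
    ∫ w in disc ×ˢ puncDisc, pullbackD α dα₁ w * ψ w =
      -(∫ z in hartogs, α 0 z * dbar 1 (fun z => conj (1 : ℂ) * z.2⁻¹ * (ψ ∘ phi) z) z)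
      - (∫ z in hartogs, α 0 z * dbar 0 (fun z => conj (z.1 / z.2) * z.2⁻¹ * (ψ ∘ phi) z) z)
      + ∫ z in hartogs, α 0 z * (conj z.2⁻¹ * z.2⁻¹ * (ψ ∘ phi) z) := by
  have hφ := hψ.comp_phi
  rw [(hweak 1).2.2 _ hφ.inv_snd_mul, (hweak 0).2.2 _ hφ.conj_div_mul, neg_neg, sub_neg_eq_add,
    setIntegral_disc_prod_puncDisc]
  have i1 := hφ.inv_snd_mul.integrableOn_mul (hdα 1)
  have i2 := hφ.conj_div_mul.integrableOn_mul (hdα 0)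
  have i3 := hφ.conj_inv_mul.integrableOn_mul hα
  have e := integral_add (i1.add i2) i3
  simp only [Pi.add_apply] at e
  rw [← integral_add i1 i2, ← e]
  refine setIntegral_congr_fun isOpen_hartogs.measurableSet fun z hz => ?_
  have h0 := snd_ne_zero_of_mem_hartogs hz
  have h1 : conj z.2 ≠ 0 := (map_ne_zero _).2 h0
  simp only [pullbackD, phiInv_phi hz, Function.comp_apply]
  rw [show (phi z).1 = z.1 / z.2 from rfl, show (phi z).2 = z.2 from rfl]
  simp only [map_inv₀, map_div₀, map_one]
  field_simp
  ring

theorem integral_pullback_zero_mul_dbar_one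
    (hα : IntegrableOn (α 0) hartogs) (hdα : ∀ j, IntegrableOn (dα₁ j) hartogs)
    (hweak : ∀ j, HasWeakDbar hartogs j (α 0) (dα₁ j))
    (hψ : IsTestFunction (disc ×ˢ puncDisc) ψ) :
    ∫ w in disc ×ˢ puncDisc, pullback α 0 w * dbar 1 ψ w =
      -∫ w in disc ×ˢ puncDisc, pullbackD α dα₁ w * ψ w := by
  have hφ := hψ.comp_phi
  rw [integral_pullbackD_mul hα hdα hweak hψ, setIntegral_disc_prod_puncDisc]
  have i1 := hφ.inv_snd_mul.integrableOn_mul_dbar hα 1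
  have i2 := hφ.conj_div_mul.integrableOn_mul_dbar hα 0
  have i3 := hφ.conj_inv_mul.integrableOn_mul hα
  have e := integral_sub (i1.add i2) i3
  simp only [Pi.add_apply] at e
  rw [neg_add', neg_sub, sub_neg_eq_add, add_comm, ← integral_add i1 i2, ← e]
  refine setIntegral_congr_fun isOpen_hartogs.measurableSet fun z hz => ?_
  have h0 := snd_ne_zero_of_mem_hartogs hz
  have h1 : conj z.2 ≠ 0 := (map_ne_zero _).2 h0
  simp only [dbar_inv_snd_mul (hφ.differentiableAt z) h0,
    dbar_zero_conj_div_mul (hφ.differentiableAt z) h0,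
    dbar_zero_comp_phi (hψ.differentiableAt (phi z)) h0,
    dbar_one_comp_phi (hψ.differentiableAt (phi z)) h0]
  simp only [pullback, Matrix.cons_val_zero, phiInv_phi hz]
  rw [show (phi z).2 = z.2 from rfl]
  simp only [map_inv₀, map_div₀, map_neg, map_pow]
  field_simp
  ring

/-- Closedness, tested on ψ∘φ / z₂, trades α₁ with ∂̄₂ for α₂ with ∂̄₁; no weak derivative of α₂ is
used separately. -/
theorem integral_pullback_one_mul_dbar_zero
    (hclosed : IsWeaklyDbarClosed hartogs α)
    (hα : ∀ j, IntegrableOn (α j) hartogs) (hdα : ∀ j, IntegrableOn (dα₁ j) hartogs)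
    (hweak : ∀ j, HasWeakDbar hartogs j (α 0) (dα₁ j))
    (hψ : IsTestFunction (disc ×ˢ puncDisc) ψ) :
    ∫ w in disc ×ˢ puncDisc, pullback α 1 w * dbar 0 ψ w =
      -∫ w in disc ×ˢ puncDisc, pullbackD α dα₁ w * ψ w := by
  have hφ := hψ.comp_phi
  rw [integral_pullbackD_mul (hα 0) hdα hweak hψ, setIntegral_disc_prod_puncDisc,
    hclosed.2 _ hφ.inv_snd_mul]
  have i1 := hφ.inv_snd_mul.integrableOn_mul_dbar (hα 1) 0
  have i2 := hφ.conj_div_mul.integrableOn_mul_dbar (hα 0) 0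
  have i3 := hφ.conj_inv_mul.integrableOn_mul (hα 0)
  have e := integral_sub (i1.add i2) i3
  simp only [Pi.add_apply] at e
  rw [neg_add', neg_sub, sub_neg_eq_add, add_comm, ← integral_add i1 i2, ← e]
  refine setIntegral_congr_fun isOpen_hartogs.measurableSet fun z hz => ?_
  have h0 := snd_ne_zero_of_mem_hartogs hz
  have h1 : conj z.2 ≠ 0 := (map_ne_zero _).2 h0
  simp only [dbar_inv_snd_mul (hφ.differentiableAt z) h0,
    dbar_zero_conj_div_mul (hφ.differentiableAt z) h0,
    dbar_zero_comp_phi (hψ.differentiableAt (phi z)) h0]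
  simp only [pullback, Matrix.cons_val_one, Matrix.cons_val_zero, phiInv_phi hz]
  rw [show (phi z).1 = z.1 / z.2 from rfl]
  simp only [map_inv₀, map_div₀]
  field_simp
  ring

/-- Transport of a weak solution from `𝔻 × 𝔻*` to the Hartogs triangle. -/
theorem integral_comp_phi_mul_dbar {u : ℂ × ℂ → ℂ}
    (hu : IntegrableOn u (disc ×ˢ puncDisc))
    (hf : ∀ j, IntegrableOn (pullback α j) (disc ×ˢ puncDisc))
    (hsol : ∀ j ψ, IsTestFunction (disc ×ˢ puncDisc) ψ →
      ∫ w in disc ×ˢ puncDisc, u w * dbar j ψ w =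
        -∫ w in disc ×ˢ puncDisc, pullback α j w * ψ w)
    {φ : ℂ × ℂ → ℂ} (hφ : IsTestFunction hartogs φ) (j : Fin 2) :
    ∫ z in hartogs, (u ∘ phi) z * dbar j φ z = -∫ z in hartogs, α j z * φ z := by
  have hψ := hφ.comp_phiInv
  have hψ0 : IsTestFunction (disc ×ˢ puncDisc)
      fun w => conj (1 : ℂ) * w.2 * (φ ∘ phiInv) w :=
    hψ.conj_mul_mul (h := fun _ => 1) (fun _ _ => contDiffAt_const) fun _ _ => contDiffAt_snd
  have hψ1 : IsTestFunction (disc ×ˢ puncDisc) fun w => conj w.2 * w.2 * (φ ∘ phiInv) w :=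
    hψ.conj_mul_mul (fun _ _ => contDiffAt_snd) fun _ _ => contDiffAt_snd
  have hψ2 : IsTestFunction (disc ×ˢ puncDisc) fun w => conj w.1 * w.2 * (φ ∘ phiInv) w :=
    hψ.conj_mul_mul (fun _ _ => contDiffAt_fst) fun _ _ => contDiffAt_snd
  rw [setIntegral_hartogs, setIntegral_hartogs]
  have hm := isOpen_disc_prod_puncDisc.measurableSet
  fin_cases j
  · have hL : ∀ w ∈ disc ×ˢ puncDisc, w.2 * conj w.2 * ((u ∘ phi) (phiInv w) * dbar 0 φ (phiInv w))
        = u w * dbar 0 (fun w => conj (1 : ℂ) * w.2 * (φ ∘ phiInv) w) w := by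
      intro w hw
      rw [dbar_eq_dbarDir 0 (fun w => conj (1 : ℂ) * w.2 * (φ ∘ phiInv) w),
        dbarDir_fderiv_conj_mul_mul (h := fun _ => 1) (hψ.differentiableAt w)
        (hasFDerivAt_const 1 w) differentiableAt_snd, ← dbar_eq_dbarDir,
        dbar_zero_comp_phiInv (hφ.differentiableAt _), Function.comp_apply, phi_phiInv hw]
      simp
      ring
    refine (setIntegral_congr_fun hm hL).trans ((hsol 0 _ hψ0).trans (congrArg Neg.neg
      (setIntegral_congr_fun hm fun w _ => ?_)))
    simp only [pullback, Matrix.cons_val_zero, Function.comp_apply, map_one, Fin.zero_eta]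
    ring
  -- The chain rule inverts to w̄₂ ∂φ/∂z̄₂ = w̄₂ ∂/∂w̄₂ - w̄₁ ∂/∂w̄₁. Moving the coefficients inside
  -- the derivatives creates two copies of w₂ (φ ∘ φ⁻¹), which cancel.
  · have hL : ∀ w ∈ disc ×ˢ puncDisc, w.2 * conj w.2 * ((u ∘ phi) (phiInv w) * dbar 1 φ (phiInv w))
        = u w * dbar 1 (fun w => conj w.2 * w.2 * (φ ∘ phiInv) w) w -
          u w * dbar 0 (fun w => conj w.1 * w.2 * (φ ∘ phiInv) w) w := by
      intro w hw
      rw [dbar_eq_dbarDir 1 (fun w => conj w.2 * w.2 * (φ ∘ phiInv) w),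
        dbarDir_fderiv_conj_mul_mul (hψ.differentiableAt w) hasFDerivAt_snd differentiableAt_snd,
        ← dbar_eq_dbarDir, dbar_one_comp_phiInv (hφ.differentiableAt _),
        dbar_eq_dbarDir 0 (fun w => conj w.1 * w.2 * (φ ∘ phiInv) w),
        dbarDir_fderiv_conj_mul_mul (hψ.differentiableAt w) hasFDerivAt_fst differentiableAt_snd,
        ← dbar_eq_dbarDir, dbar_zero_comp_phiInv (hφ.differentiableAt _),
        Function.comp_apply (f := u), phi_phiInv hw]
      simp [coordVec]
      ring
    refine (setIntegral_congr_fun hm hL).trans ?_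
    rw [integral_sub (hψ1.integrableOn_mul_dbar hu 1) (hψ2.integrableOn_mul_dbar hu 0),
      hsol 1 _ hψ1, hsol 0 _ hψ2, sub_neg_eq_add, neg_add_eq_sub, ← neg_sub,
      ← integral_sub (hψ1.integrableOn_mul (hf 1)) (hψ2.integrableOn_mul (hf 0))]
    refine congrArg Neg.neg (setIntegral_congr_fun hm fun w _ => ?_)
    simp only [pullback, Matrix.cons_val_zero, Matrix.cons_val_one, Function.comp_apply, Fin.mk_one]
    ring

end Pullback

/-! ### Uniqueness of the function representing 𝒟f. -/

section ScriptD

theorem integrableOn_of_memLp {Ω : Set (ℂ × ℂ)} {F : ℂ × ℂ → ℂ} {p : ℝ≥0∞} (hp : 1 ≤ p)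
    [IsFiniteMeasure (volume.restrict Ω)] (hF : MemLp F p (volume.restrict Ω)) :
    IntegrableOn F Ω := hF.integrable hp

/-- Two locally integrable functions that represent the same distribution agree almost everywhere. -/
theorem IsScriptD.ae_eq {Ω : Set (ℂ × ℂ)} (hΩ : IsOpen Ω) {f : Form01} {g g' : ℂ × ℂ → ℂ}
    (hg : IsScriptD Ω f g) (hg' : IsScriptD Ω f g') : g =ᵐ[volume.restrict Ω] g' := by
  have key := hΩ.ae_eq_zero_of_integral_contDiff_smul_eq_zero (hg.2.1.sub hg'.2.1)
    (fun χ hχ hχc hχs => ?_)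
  · rw [Filter.EventuallyEq, ae_restrict_iff' hΩ.measurableSet]
    filter_upwards [key] with z hz hzΩ
    exact sub_eq_zero.1 (hz hzΩ)
  · have hχt : tsupport (fun z => (χ z : ℂ)) ⊆ tsupport χ :=
      closure_mono fun z hz h => hz (by simp [h])
    have htest : IsTestFunction Ω fun z => (χ z : ℂ) :=
      ⟨ofRealCLM.contDiff.comp hχ, hχc.mono fun z hz h => hz (by simp [h]), hχt.trans hχs⟩
    have hint : ∀ {h : ℂ × ℂ → ℂ}, LocallyIntegrableOn h Ω →
        IntegrableOn (fun z => h z * (χ z : ℂ)) Ω := by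
      intro h hh
      have h1 : IntegrableOn (fun z => h z * (χ z : ℂ)) (tsupport χ) := by
        obtain ⟨c, hc⟩ := hχc.exists_bound_of_continuous hχ.continuous
        exact (hh.integrableOn_compact_subset hχs hχc.isCompact).mul_bdd (c := c)
          htest.1.continuous.aestronglyMeasurable (.of_forall fun z => by simpa using hc z)
      refine h1.of_forall_sdiff_eq_zero hΩ.measurableSet fun z hz => ?_
      rw [image_eq_zero_of_notMem_tsupport hz.2, ofReal_zero, mul_zero]
    have e := (hg.2.2 _ htest).symm.trans (hg'.2.2 _ htest)
    rw [neg_inj] at e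
    rw [← setIntegral_eq_integral_of_forall_compl_eq_zero (s := Ω) fun z hz => by
      rw [image_eq_zero_of_notMem_tsupport fun h => hz (hχs h), zero_smul]]
    rw [← sub_eq_zero, ← integral_sub (hint hg.2.1) (hint hg'.2.1)] at e
    rw [← e]
    refine integral_congr_ae (.of_forall fun z => ?_)
    simp only [real_smul, Pi.sub_apply]
    ring

theorem isScriptD_scriptD {Ω : Set (ℂ × ℂ)} {f : Form01} {g : ℂ × ℂ → ℂ} (hg : IsScriptD Ω f g) :
    IsScriptD Ω f (scriptD Ω f) := by
  have h : ∃ g, IsScriptD Ω f g := ⟨g, hg⟩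
  rw [scriptD, dif_pos h]
  exact h.choose_spec

end ScriptD

/-! ### Weighted measures and L^p estimates for the pulled-back form. -/

instance isFiniteMeasure_disc_prod_puncDisc :
    IsFiniteMeasure (volume.restrict (disc ×ˢ puncDisc) : Measure (ℂ × ℂ)) := by
  rw [restrict_disc_prod_puncDisc]
  infer_instance

instance isFiniteMeasure_hartogs : IsFiniteMeasure (volume.restrict hartogs : Measure (ℂ × ℂ)) := by
  have hsub : hartogs ⊆ disc ×ˢ puncDisc := fun z hz =>
    ⟨hz.1.trans hz.2, (norm_nonneg _).trans_lt hz.1, hz.2⟩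
  exact isFiniteMeasure_of_le _ (Measure.restrict_mono hsub le_rfl)

theorem measurable_weight (s : ℝ) :
    Measurable fun z : ℂ × ℂ => ENNReal.ofReal (‖z.2‖ ^ s) :=
  (measurable_snd.norm.pow_const s).ennreal_ofReal

theorem measurable_phiInv : Measurable phiInv :=
  (measurable_fst.mul measurable_snd).prodMk measurable_snd

theorem measurable_phi : Measurable phi :=
  (measurable_fst.div measurable_snd).prodMk measurable_snd

/-- The map `φ⁻¹` carries Lebesgue measure on `𝔻 × 𝔻*` to the measure `|z₂|⁻² dV`. -/
theorem measurePreserving_phiInv :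
    MeasurePreserving phiInv (volume.restrict (disc ×ˢ puncDisc)) (weighted (-2)) := by
  refine ⟨measurable_phiInv, ?_⟩
  ext s hs
  have hms := isOpen_disc_prod_puncDisc.measurableSet.inter (measurable_phiInv hs)
  rw [Measure.map_apply measurable_phiInv hs, weighted, withDensity_apply _ hs,
    Measure.restrict_restrict hs, Set.inter_comm s, ← image_phiInv,
    lintegral_image_eq_lintegral_abs_det_fderiv_mul volume hms
      (fun w _ => ((hasFDerivAt_phiInv w).restrictScalars ℝ).hasFDerivWithinAt)
      (injOn_phiInv.mono Set.inter_subset_left),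
    Measure.restrict_apply (measurable_phiInv hs), Set.inter_comm, ← setLIntegral_one]
  refine setLIntegral_congr_fun hms fun w hw => ?_
  have h0 : 0 < ‖w.2‖ := hw.1.2.1
  simp only [det_phiInvDeriv]
  rw [show (phiInv w).2 = w.2 from rfl, ← ENNReal.ofReal_mul (abs_nonneg _),
    abs_of_nonneg (by positivity), ← Real.rpow_natCast, ← Real.rpow_add h0]
  norm_num

theorem measurePreserving_phi :
    MeasurePreserving phi (weighted (-2)) (volume.restrict (disc ×ˢ puncDisc)) := by
  refine ⟨measurable_phi, ?_⟩
  rw [← measurePreserving_phiInv.map_eq, Measure.map_map measurable_phi measurable_phiInv]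
  conv_rhs => rw [← Measure.map_id (μ := volume.restrict (disc ×ˢ puncDisc))]
  refine Measure.map_congr ?_
  filter_upwards [ae_restrict_mem isOpen_disc_prod_puncDisc.measurableSet] with w hw
  exact phi_phiInv hw

/-- Since |z₂| < 1 on the domain, a nonpositive power of |z₂| is at least 1. -/
theorem restrict_hartogs_le_weighted {s : ℝ} (hs : s ≤ 0) :
    volume.restrict hartogs ≤ weighted s := by
  rw [weighted]
  conv_lhs => rw [← withDensity_one (μ := volume.restrict hartogs)]
  refine withDensity_mono ?_
  filter_upwards [ae_restrict_mem isOpen_hartogs.measurableSet] with z hz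
  rw [Pi.one_apply, ← ENNReal.ofReal_one]
  exact ENNReal.ofReal_le_ofReal
    (Real.one_le_rpow_of_pos_of_le_one_of_nonpos ((norm_nonneg _).trans_lt hz.1) hz.2.le hs)

/-- The factor contributes |z₂|^p, and p - 2 ≥ -1 because p ≥ 1; on |z₂| < 1 this gives |z₂|^(p-2) ≤
|z₂|⁻¹. -/
theorem eLpNorm_conj_snd_mul_le {p : ℝ≥0∞} (hp : 1 ≤ p) (hp' : p ≠ ⊤) (h : ℂ × ℂ → ℂ) :
    eLpNorm (fun z => conj z.2 * h z) p (weighted (-2)) ≤ eLpNorm h p (weighted (-1)) := by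
  have hp0 : p ≠ 0 := (zero_lt_one.trans_le hp).ne'
  have hp1 : 1 ≤ p.toReal := by simpa using ENNReal.toReal_mono hp' hp
  rw [eLpNorm_eq_lintegral_rpow_enorm_toReal hp0 hp', eLpNorm_eq_lintegral_rpow_enorm_toReal hp0 hp']
  refine ENNReal.rpow_le_rpow ?_ (by positivity)
  rw [weighted, weighted,
    lintegral_withDensity_eq_lintegral_mul_non_measurable _ (measurable_weight _)
      (.of_forall fun _ => ENNReal.ofReal_lt_top),
    lintegral_withDensity_eq_lintegral_mul_non_measurable _ (measurable_weight _)
      (.of_forall fun _ => ENNReal.ofReal_lt_top)]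
  refine lintegral_mono_ae ?_
  filter_upwards [ae_restrict_mem isOpen_hartogs.measurableSet] with z hz
  have h0 : 0 < ‖z.2‖ := (norm_nonneg _).trans_lt hz.1
  simp only [Pi.mul_apply]
  rw [enorm_mul, ENNReal.mul_rpow_of_nonneg _ _ (by linarith), ← mul_assoc]
  gcongr
  rw [← ofReal_norm, norm_conj, ENNReal.ofReal_rpow_of_pos h0,
    ← ENNReal.ofReal_mul (by positivity), ← Real.rpow_add h0]
  exact ENNReal.ofReal_le_ofReal
    (Real.rpow_le_rpow_of_exponent_ge h0 hz.2.le (by linarith))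

section Estimates

variable {p : ℝ≥0∞} {α : Form01} {dα₁ : Fin 2 → ℂ × ℂ → ℂ}

theorem memLp_comp_phiInv {h : ℂ × ℂ → ℂ} (hh : MemLp h p (weighted (-2))) :
    MemLp (fun w => h (phiInv w)) p (volume.restrict (disc ×ˢ puncDisc)) ∧
      eLpNorm (fun w => h (phiInv w)) p (volume.restrict (disc ×ˢ puncDisc)) =
        eLpNorm h p (weighted (-2)) :=
  ⟨hh.comp_measurePreserving measurePreserving_phiInv,
    eLpNorm_comp_measurePreserving hh.1 measurePreserving_phiInv⟩

theorem memLp_conj_snd_mul (hp : 1 ≤ p) (hp' : p ≠ ⊤) {h : ℂ × ℂ → ℂ}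
    (hh : MemLp h p (weighted (-1))) :
    MemLp (fun w => conj w.2 * h (phiInv w)) p (volume.restrict (disc ×ˢ puncDisc)) ∧
      eLpNorm (fun w => conj w.2 * h (phiInv w)) p (volume.restrict (disc ×ˢ puncDisc)) ≤
        eLpNorm h p (weighted (-1)) := by
  have hac : weighted (-2) ≪ weighted (-1) :=
    (withDensity_absolutelyContinuous _ _).trans
      (restrict_hartogs_le_weighted (by norm_num)).absolutelyContinuous
  have hm : AEStronglyMeasurable (fun z : ℂ × ℂ => conj z.2 * h z) (weighted (-2)) :=
    (continuous_conj.comp continuous_snd).aestronglyMeasurable.mul (hh.1.mono_ac hac)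
  have hle := eLpNorm_conj_snd_mul_le hp hp' h
  have := memLp_comp_phiInv (h := fun z => conj z.2 * h z) ⟨hm, hle.trans_lt hh.2⟩
  exact ⟨this.1, this.2.trans_le hle⟩

theorem memLp_bdd_mul {μ : Measure (ℂ × ℂ)} {a h : ℂ × ℂ → ℂ} (ha : Continuous a)
    (ha1 : ∀ᵐ w ∂μ, ‖a w‖ ≤ 1) (hh : MemLp h p μ) :
    MemLp (fun w => a w * h w) p μ ∧ eLpNorm (fun w => a w * h w) p μ ≤ eLpNorm h p μ := by
  have hle : eLpNorm (fun w => a w * h w) p μ ≤ eLpNorm h p μ := by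
    refine eLpNorm_mono_ae ?_
    filter_upwards [ha1] with w hw
    rw [norm_mul]
    exact mul_le_of_le_one_left (norm_nonneg _) hw
  exact ⟨⟨ha.aestronglyMeasurable.mul hh.1, hle.trans_lt hh.2⟩, hle⟩

theorem ae_norm_conj_fst_le :
    ∀ᵐ w ∂(volume.restrict (disc ×ˢ puncDisc) : Measure (ℂ × ℂ)), ‖conj w.1‖ ≤ 1 := by
  filter_upwards [ae_restrict_mem isOpen_disc_prod_puncDisc.measurableSet] with w hw
  rw [norm_conj]
  exact le_of_lt hw.1

theorem ae_norm_conj_snd_le :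
    ∀ᵐ w ∂(volume.restrict (disc ×ˢ puncDisc) : Measure (ℂ × ℂ)), ‖conj w.2‖ ≤ 1 := by
  filter_upwards [ae_restrict_mem isOpen_disc_prod_puncDisc.measurableSet] with w hw
  rw [norm_conj]
  exact hw.2.2.le

theorem memLp_pullback_zero (hα : ∀ j, MemLp (α j) p (weighted (-2))) :
    MemLp (pullback α 0) p (volume.restrict (disc ×ˢ puncDisc)) ∧
      eLpNorm (pullback α 0) p (volume.restrict (disc ×ˢ puncDisc)) ≤
        eLpNorm (α 0) p (weighted (-2)) := by
  have h := memLp_comp_phiInv (hα 0)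
  have h' := memLp_bdd_mul (continuous_conj.comp continuous_snd) ae_norm_conj_snd_le h.1
  exact ⟨h'.1, h'.2.trans_eq h.2⟩

theorem memLp_pullback_one (hp : 1 ≤ p) (hα : ∀ j, MemLp (α j) p (weighted (-2))) :
    MemLp (pullback α 1) p (volume.restrict (disc ×ˢ puncDisc)) ∧
      eLpNorm (pullback α 1) p (volume.restrict (disc ×ˢ puncDisc)) ≤
        eLpNorm (α 0) p (weighted (-2)) + eLpNorm (α 1) p (weighted (-2)) := by
  have h := memLp_comp_phiInv (hα 0)
  have h1 := memLp_comp_phiInv (hα 1)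
  have h' := memLp_bdd_mul (continuous_conj.comp continuous_fst) ae_norm_conj_fst_le h.1
  exact ⟨h'.1.add h1.1, (eLpNorm_add_le h'.1.1 h1.1.1 hp).trans
    (add_le_add (h'.2.trans_eq h.2) h1.2.le)⟩

theorem memLp_pullbackD (hp : 1 ≤ p) (hp' : p ≠ ⊤) (hα : ∀ j, MemLp (α j) p (weighted (-2)))
    (hdα : ∀ j, MemLp (dα₁ j) p (weighted (-1))) :
    MemLp (pullbackD α dα₁) p (volume.restrict (disc ×ˢ puncDisc)) ∧
      eLpNorm (pullbackD α dα₁) p (volume.restrict (disc ×ˢ puncDisc)) ≤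
        eLpNorm (dα₁ 0) p (weighted (-1)) + eLpNorm (dα₁ 1) p (weighted (-1)) +
          eLpNorm (α 0) p (weighted (-2)) := by
  have h := memLp_comp_phiInv (hα 0)
  have h0 := memLp_conj_snd_mul hp hp' (hdα 0)
  have h1 := memLp_conj_snd_mul hp hp' (hdα 1)
  have h0' := memLp_bdd_mul (continuous_conj.comp continuous_fst) ae_norm_conj_fst_le h0.1
  have e : pullbackD α dα₁ = ((fun w => conj w.1 * (conj w.2 * dα₁ 0 (phiInv w))) +
      fun w => conj w.2 * dα₁ 1 (phiInv w)) + fun w => α 0 (phiInv w) := by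
    funext w
    simp only [pullbackD, Pi.add_apply]
    ring
  rw [e]
  exact ⟨(h0'.1.add h1.1).add h.1, (eLpNorm_add_le (h0'.1.add h1.1).1 h.1.1 hp).trans
    (add_le_add ((eLpNorm_add_le h0'.1.1 h1.1.1 hp).trans
      (add_le_add (h0'.2.trans h0.2) h1.2)) h.2.le)⟩

end Estimates

end HartogsDbar

/-! ### Assembly of the theorem. -/

open HartogsDbar

theorem theorem5p1 (p : ℝ≥0∞) (hp_one : 1 ≤ p) (hp_top : p ≠ ⊤) :
    ∃ C : ℝ≥0, 0 < C ∧
      ∀ (α : HartogsDbar.Form01) (dα₁ : Fin 2 → ℂ × ℂ → ℂ),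
        HartogsDbar.IsWeaklyDbarClosed HartogsDbar.hartogs α →
        (∀ j, MemLp (α j) p (HartogsDbar.weighted (-2))) →
        -- `dα₁ j` is the weak derivative of `α₁` with respect to the conjugate of the `j`-th variable
        (∀ j, HartogsDbar.HasWeakDbar HartogsDbar.hartogs j (α 0) (dα₁ j)) →
        (∀ j, MemLp (dα₁ j) p (HartogsDbar.weighted (-1))) →
        HartogsDbar.MemB (HartogsDbar.disc ×ˢ HartogsDbar.puncDisc) p (HartogsDbar.pullback α) ∧
        (∀ᵐ w ∂(volume.restrict (HartogsDbar.disc ×ˢ HartogsDbar.puncDisc)),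
          HartogsDbar.TConverges (HartogsDbar.pullback α) w) ∧
        HartogsDbar.IsWeakSolution HartogsDbar.hartogs
          (HartogsDbar.T (HartogsDbar.pullback α) ∘ HartogsDbar.phi) α ∧
        MemLp (HartogsDbar.T (HartogsDbar.pullback α) ∘ HartogsDbar.phi) p
          (volume.restrict HartogsDbar.hartogs) ∧
        eLpNorm (HartogsDbar.T (HartogsDbar.pullback α) ∘ HartogsDbar.phi) p
            (volume.restrict HartogsDbar.hartogs)
          ≤ C * (∑ j, eLpNorm (α j) p (HartogsDbar.weighted (-2))
                + ∑ j, eLpNorm (dα₁ j) p (HartogsDbar.weighted (-1))) := by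
  obtain ⟨A, hK⟩ := exists_schurKernel_cauchyKernel
  -- Two single transforms cost A each and the double one A²; the summand 1 only ensures positivity.
  refine ⟨2 * A + A * A + 1, by positivity, ?_⟩
  intro α dα₁ hclosed hα hweak hdα
  have hαint : ∀ j, IntegrableOn (α j) hartogs := fun j =>
    integrableOn_of_memLp hp_one ((hα j).mono_measure (restrict_hartogs_le_weighted (by norm_num)))
  have hdint : ∀ j, IntegrableOn (dα₁ j) hartogs := fun j =>
    integrableOn_of_memLp hp_one ((hdα j).mono_measure (restrict_hartogs_le_weighted (by norm_num)))
  have hf0 := memLp_pullback_zero hα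
  have hf1 := memLp_pullback_one hp_one hα
  have hg := memLp_pullbackD hp_one hp_top hα hdα
  have hf : ∀ j, MemLp (pullback α j) p (volume.restrict (disc ×ˢ puncDisc)) := by
    intro j
    fin_cases j
    exacts [hf0.1, hf1.1]
  have hfint : ∀ j, IntegrableOn (pullback α j) (disc ×ˢ puncDisc) := fun j =>
    integrableOn_of_memLp hp_one (hf j)
  have hgint := integrableOn_of_memLp hp_one hg.1
  have w0 := fun ψ (hψ : IsTestFunction (disc ×ˢ puncDisc) ψ) =>
    integral_pullback_zero_mul_dbar_one (hαint 0) hdint hweak hψ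
  have w1 := fun ψ (hψ : IsTestFunction (disc ×ˢ puncDisc) ψ) =>
    integral_pullback_one_mul_dbar_zero hclosed hαint hdint hweak hψ
  have hD : IsScriptD (disc ×ˢ puncDisc) (pullback α) (pullbackD α dα₁) := by
    refine ⟨fun j => (hfint j).locallyIntegrableOn, hgint.locallyIntegrableOn, fun φ hφ => ?_⟩
    rw [w0 φ hφ, w1 φ hφ]
    ring
  have hD' := isScriptD_scriptD hD
  -- `scriptD` is an arbitrary choice of representative, so it is identified almost everywhere with
  -- the explicit `pullbackD`.
  have hDe := hD'.ae_eq isOpen_disc_prod_puncDisc hD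
  have hTe := T_ae_eq_solOp (f := pullback α) (g := pullbackD α dα₁)
    (by rw [← restrict_disc_prod_puncDisc]; exact hgint)
    (by rw [← restrict_disc_prod_puncDisc]; exact hDe)
  have hfint' := hfint
  have hgint' := hgint
  simp only [IntegrableOn, restrict_disc_prod_puncDisc] at hfint' hgint'
  have hle := eLpNorm_solOp_le hK hfint' hgint' hp_one hp_top
  rw [← restrict_disc_prod_puncDisc] at hTe hle
  set N := ∑ j, eLpNorm (α j) p (weighted (-2)) + ∑ j, eLpNorm (dα₁ j) p (weighted (-1))
  have hN : N = (eLpNorm (α 0) p (weighted (-2)) + eLpNorm (α 1) p (weighted (-2))) +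
      (eLpNorm (dα₁ 0) p (weighted (-1)) + eLpNorm (dα₁ 1) p (weighted (-1))) := by
    simp only [N, Fin.sum_univ_two]
  have hNfin : N < ⊤ := ENNReal.add_lt_top.2
    ⟨ENNReal.sum_lt_top.2 fun j _ => (hα j).2, ENNReal.sum_lt_top.2 fun j _ => (hdα j).2⟩
  have hTm : AEStronglyMeasurable (T (pullback α)) (volume.restrict (disc ×ˢ puncDisc)) := by
    have := (integrable_solOp hfint' hgint').1
    rw [← restrict_disc_prod_puncDisc] at this
    exact this.congr hTe.symm
  have hTle : eLpNorm (T (pullback α)) p (volume.restrict (disc ×ˢ puncDisc)) ≤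
      ((2 * A + A * A + 1 : ℝ≥0) : ℝ≥0∞) * N := by
    rw [eLpNorm_congr_ae hTe]
    refine hle.trans ?_
    have b0 : eLpNorm (pullback α 0) p (volume.restrict (disc ×ˢ puncDisc)) ≤ N :=
      hf0.2.trans (by rw [hN, add_assoc]; exact le_self_add)
    have b1 : eLpNorm (pullback α 1) p (volume.restrict (disc ×ˢ puncDisc)) ≤ N :=
      hf1.2.trans (by rw [hN]; exact le_self_add)
    have b2 : eLpNorm (pullbackD α dα₁) p (volume.restrict (disc ×ˢ puncDisc)) ≤ N := by
      refine hg.2.trans ?_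
      rw [hN, add_comm]
      gcongr
      exact le_self_add
    calc _ ≤ (A : ℝ≥0∞) * N + A * N + A * (A * N) := by gcongr
      _ ≤ A * N + A * N + A * (A * N) + N := le_self_add
      _ = _ := by
        push_cast
        ring
  have hvm : AEStronglyMeasurable (T (pullback α) ∘ phi) (weighted (-2)) :=
    hTm.comp_measurePreserving measurePreserving_phi
  have hvle : eLpNorm (T (pullback α) ∘ phi) p (volume.restrict hartogs) ≤
      ((2 * A + A * A + 1 : ℝ≥0) : ℝ≥0∞) * N := by
    refine (eLpNorm_mono_measure _ (restrict_hartogs_le_weighted (s := -2) (by norm_num))).trans ?_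
    rw [eLpNorm_comp_measurePreserving hTm measurePreserving_phi]
    exact hTle
  have hv : MemLp (T (pullback α) ∘ phi) p (volume.restrict hartogs) :=
    ⟨hvm.mono_measure (restrict_hartogs_le_weighted (s := -2) (by norm_num)),
      hvle.trans_lt (ENNReal.mul_lt_top ENNReal.coe_lt_top hNfin)⟩
  refine ⟨⟨hf, hD', hg.1.ae_eq hDe.symm⟩, ?_, fun j => ⟨?_, hclosed.1 j, fun φ hφ => ?_⟩, hv, hvle⟩
  · rw [restrict_disc_prod_puncDisc]
    refine ae_TConverges hfint' ?_
    rw [← restrict_disc_prod_puncDisc]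
    exact hgint.congr hDe.symm
  · exact (integrableOn_of_memLp hp_one hv).locallyIntegrableOn
  · have hTint : IntegrableOn (T (pullback α)) (disc ×ˢ puncDisc) := by
      have := integrable_solOp hfint' hgint'
      rw [← restrict_disc_prod_puncDisc] at this
      exact this.congr hTe.symm
    refine integral_comp_phi_mul_dbar hTint hfint (fun j ψ hψ => ?_) hφ j
    rw [← isWeakSolution_solOp hfint' hgint' w0 w1 hψ j]
    refine integral_congr_ae ?_
    filter_upwards [hTe] with w hw
    rw [hw]
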